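/- Let $A\in\mathbb R^{n\times n}$ and $B\in\mathbb R^{n\times m}$ be constant matrices, let $u:[0,\infty)\to\mathbb R^m$ be continuous, and for each $t\ge 0$ let $D(t)$ be a diagonal $n\times n$ matrix with $D_{ii}(t)>0$. Consider an $n$-th order linear Gaussian process whose density at time $t\ge 0$ is $$p(x;t)=\det(2\pi\Sigma(t))^{-1/2}\exp\!\left(-\tfrac12 (x-\mu(t))^\top\Sigma(t)^{-1}(x-\mu(t))\right),\qquad x\in\mathbb R^n,$$ where $\Sigma(t)$ is symmetric positive definite and, for all $t\ge 0$ (with one-sided derivatives at $0$), $$\dot\mu=A\mu+Bu,\qquad \dot\Sigma=A\Sigma+\Sigma A^\top+2D .$$ Put $f(x;t)=Ax+Bu(t)$ and $J_i=f_i\,p-\sum_j D_{ij}\,\partial_{x_j}p$, and define $$\Pi=\int_{\mathbb R^n}\sum_i\frac{J_i^2}{D_{ii}\,p}\,dx,\qquad \Pi_{J_i}=\int_{\mathbb R^n}\frac{J_i^2}{D_{ii}\,p}\,dx,\qquad \Phi_{J_i}=\int_{\mathbb R^n}\frac{J_i f_i}{D_{ii}}\,dx,$$ $$\dot S=-\int_{\mathbb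 R^n}(\partial_t p)\ln p\,dx,\qquad \dot S_{J_i}=\int_{\mathbb R^n}(\partial_{x_i}J_i)\ln p\,dx,\qquad \Gamma=\left(\int_{\mathbb R^n}p\,(\partial_t\ln p)^2\,dx\right)^{1/2}.$$ Then for every $t\ge 0$ all these integrals converge absolutely, $\dot S_{J_i}=\Pi_{J_i}-\Phi_{J_i}$ for every $i$, $$\Gamma^2=\dot\mu^\top\Sigma^{-1}\dot\mu+\tfrac12\operatorname{Tr}\!\left((\Sigma^{-1}\dot\Sigma)^2\right),$$ and $$0\le\Gamma^2\le\mathcal E_u:=\operatorname{Tr}(\Sigma^{-1})\,\Pi\,\operatorname{Tr}(D)+\dot S^2-2g(\mathbf s),\qquad g(\mathbf s)=\sum_{i<j}\dot S_{J_i}\dot S_{J_j},\quad \mathbf s=(\dot S_{J_1},\dots,\dot S_{J_n}).$$ Consequently, for every $T\ge 0$ such that $D$ is continuous on $[0,T]$, the functions $\Gamma$ and $\sqrt{\mathcal E_u}$ are integrable on $[0,T]$, and the information length $\mathcal L(T)=\int_0^T\Gamma(t)\,dt$ satisfies $$\mathcal L(T)\le\int_0^T\sqrt{\mathcal E_u(t)}\,dt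 .$$ -/

import Mathlib

open MeasureTheory Set
open scoped Matrix

noncomputable section

/-- The Gaussian density on `ℝⁿ` with mean `m` and covariance matrix `S`,
`(det (2πS))^(-1/2) * exp (-(1/2) (x - m)ᵀ S⁻¹ (x - m))`. -/
def gaussianDensity {n : ℕ} (m : Fin n → ℝ) (S : Matrix (Fin n) (Fin n) ℝ) (x : Fin n → ℝ) : ℝ :=
  1 / √(((2 * Real.pi) • S).det) * Real.exp (-(1 / 2) * ((x - m) ⬝ᵥ (S⁻¹ *ᵥ (x - m))))

/-- The function `g(s) = ∑_{i<j} s_i s_j`. -/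
def pairSum {n : ℕ} (s : Fin n → ℝ) : ℝ :=
  ∑ q : Fin n × Fin n with q.1 < q.2, s q.1 * s q.2

/-- A linear Gaussian process of order `n` with `m` inputs on the time interval `[0, ∞)`:
the linear Langevin system `dx/dt = A x + B u(t) + ξ(t)` with noise correlations
`⟨ξ_i(t) ξ_j(t')⟩ = 2 D_ij(t) δ(t - t')`, the noise matrix being diagonal with positive diagonal
entries, and the (nondegenerate) Gaussian laws of its state, given by their mean and covariance,
which solve `μ' = A μ + B u` and `Σ' = A Σ + Σ Aᵀ + 2 D` (one-sided derivatives at time `0`). -/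
structure LinearGaussianProcess (n m : ℕ) where
  /-- the drift matrix -/
  A : Matrix (Fin n) (Fin n) ℝ
  /-- the input matrix -/
  B : Matrix (Fin n) (Fin m) ℝ
  /-- the deterministic input -/
  u : ℝ → Fin m → ℝ
  /-- the noise amplitude matrix -/
  D : ℝ → Matrix (Fin n) (Fin n) ℝ
  /-- the mean -/
  mean : ℝ → Fin n → ℝ
  /-- the covariance matrix -/
  cov : ℝ → Matrix (Fin n) (Fin n) ℝ
  u_continuousOn : ContinuousOn u (Ici 0)
  D_isDiag : ∀ t, 0 ≤ t → (D t).IsDiag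
  D_pos : ∀ t, 0 ≤ t → ∀ i, 0 < D t i i
  cov_posDef : ∀ t, 0 ≤ t → (cov t).PosDef
  mean_ode : ∀ t, 0 ≤ t → HasDerivWithinAt mean (A *ᵥ mean t + B *ᵥ u t) (Ici 0) t
  cov_ode : ∀ t, 0 ≤ t → ∀ i j,
    HasDerivWithinAt (fun s => cov s i j) ((A * cov t + cov t * Aᵀ + (2 : ℝ) • D t) i j) (Ici 0) t

namespace LinearGaussianProcess

variable {n m : ℕ} (P : LinearGaussianProcess n m)

/-- The probability density `p(x; t)` of the state at time `t`. -/
def pdf (t : ℝ) (x : Fin n → ℝ) : ℝ :=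
  gaussianDensity (P.mean t) (P.cov t) x

/-- The force `f(x; t) = A x + B u(t)`. -/
def force (t : ℝ) (x : Fin n → ℝ) : Fin n → ℝ :=
  P.A *ᵥ x + P.B *ᵥ P.u t

/-- The probability current `J_i = f_i p - ∑_j D_ij ∂p/∂x_j`. -/
def current (t : ℝ) (x : Fin n → ℝ) (i : Fin n) : ℝ :=
  P.force t x i * P.pdf t x - ∑ j, P.D t i j * lineDeriv ℝ (P.pdf t) x (Pi.single j 1)

/-- The time derivative `∂p/∂t (x; t)`. -/
def pdfDot (t : ℝ) (x : Fin n → ℝ) : ℝ :=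
  derivWithin (fun s => P.pdf s x) (Ici 0) t

/-- The time derivative `∂(ln p)/∂t (x; t)`. -/
def logPdfDot (t : ℝ) (x : Fin n → ℝ) : ℝ :=
  derivWithin (fun s => Real.log (P.pdf s x)) (Ici 0) t

/-- The time derivative of the mean. -/
def meanDot (t : ℝ) : Fin n → ℝ :=
  derivWithin P.mean (Ici 0) t

/-- The (entrywise) time derivative of the covariance matrix. -/
def covDot (t : ℝ) : Matrix (Fin n) (Fin n) ℝ :=
  Matrix.of fun i j => derivWithin (fun s => P.cov s i j) (Ici 0) t

/-- The entropy rate `-∫ (∂p/∂t) ln p dx`. -/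
def entropyRate (t : ℝ) : ℝ :=
  -∫ x, P.pdfDot t x * Real.log (P.pdf t x)

/-- The entropy production `Π = ∫ ∑_i J_i² / (D_ii p) dx`. -/
def entropyProduction (t : ℝ) : ℝ :=
  ∫ x, ∑ i, P.current t x i ^ 2 / (P.D t i i * P.pdf t x)

/-- The entropy production of the current `J_i`. -/
def currentProduction (t : ℝ) (i : Fin n) : ℝ :=
  ∫ x, P.current t x i ^ 2 / (P.D t i i * P.pdf t x)

/-- The entropy flow of the current `J_i` (for a diagonal noise matrix). -/
def currentFlow (t : ℝ) (i : Fin n) : ℝ :=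
  ∫ x, P.current t x i * P.force t x i / P.D t i i

/-- The integrand `(∂J_i/∂x_i) ln p` of the entropy rate contribution of `J_i`. -/
def currentRateIntegrand (t : ℝ) (i : Fin n) (x : Fin n → ℝ) : ℝ :=
  lineDeriv ℝ (fun y => P.current t y i) x (Pi.single i 1) * Real.log (P.pdf t x)

/-- The contribution `∫ (∂J_i/∂x_i) ln p dx` of the current `J_i` to the entropy rate. -/
def currentRate (t : ℝ) (i : Fin n) : ℝ :=
  ∫ x, P.currentRateIntegrand t i x

/-- The information rate `Γ = (∫ p (∂(ln p)/∂t)² dx)^(1/2)`. -/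
def informationRate (t : ℝ) : ℝ :=
  √(∫ x, P.pdf t x * P.logPdfDot t x ^ 2)

/-- The upper bound `Tr(Σ⁻¹) Π Tr(D) + (entropy rate)² - 2 g(s)`, where `s` is the vector of the
contributions of the currents to the entropy rate. -/
def rateBound (t : ℝ) : ℝ :=
  ((P.cov t)⁻¹).trace * P.entropyProduction t * (P.D t).trace
    + P.entropyRate t ^ 2 - 2 * pairSum (P.currentRate t)

/-- The information length `L(T) = ∫₀ᵀ Γ(t) dt`. -/
def informationLength (T : ℝ) : ℝ :=
  ∫ t in (0 : ℝ)..T, P.informationRate t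

end LinearGaussianProcess

end

/-! For Gaussian `p` the local mean velocity `J / p` is affine: it equals `c + K y` with `c = μ'`,
`y = x - μ` and `K = A + D Σ⁻¹`. Temperate-growth functions are integrable against `p`, and Stein's
identity `∫ ∂ᵥF p = ∫ F (v · Σ⁻¹y) p` reduces every integral to first and second moments
(`integral_affine_mul_affine_mul_gaussianDensity`, `integral_lineDeriv_mul_gaussianDensity_mul`).
With `M = diag (K Σ Kᵀ)` this gives `Π_{J_i} = (c_i² + M_i) / D_ii` and `Ṡ_{J_i} = K_ii`. The
Fokker–Planck equation `∂ₜ ln p = -∑ (∂_i J_i) / p` then gives `Γ² = cᵀΣ⁻¹c + Tr K² + Tr (Σ⁻¹KΣKᵀ)`,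
and also `Ṡ = ∑ K_ii`, hence `Ṡ² - 2g = ∑ K_ii²`.

What remains is the matrix inequality `Matrix.PosDef.rate_inequality`. Let `τ = Tr Σ⁻¹` and expand
`τ (∑ M_i / D_ii) (∑ D_jj)` as a double sum. Its diagonal `τ ∑ M_i` dominates `Tr (Σ⁻¹KΣKᵀ)`. Its
off-diagonal part dominates `∑_{i≠j} K_ij K_ji = Tr K² - ∑ K_ii²`, by weighted AM–GM and `K_ij² ≤ τ
M_i`. The terms `c_i²` absorb `cᵀΣ⁻¹c`. -/

/-! ### Inequalities for positive definite matrices -/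

open scoped MatrixOrder in
/-- A positive definite real matrix factors as `R * Rᵀ` with `R` invertible. -/
theorem Matrix.PosDef.exists_eq_mul_transpose {n : ℕ} {S : Matrix (Fin n) (Fin n) ℝ}
    (hS : S.PosDef) : ∃ R : Matrix (Fin n) (Fin n) ℝ, S = R * Rᵀ ∧ R.det ≠ 0 := by
  obtain ⟨B, hB⟩ := CStarAlgebra.nonneg_iff_eq_star_mul_self.mp hS.posSemidef.nonneg
  have h : S = Bᵀ * Bᵀᵀ := by
    rw [hB, Matrix.star_eq_conjTranspose, Matrix.conjTranspose_eq_transpose_of_trivial,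
      Matrix.transpose_transpose]
  refine ⟨Bᵀ, h, fun h0 => hS.det_pos.ne' ?_⟩
  rw [h, Matrix.det_mul, h0, zero_mul]

theorem Matrix.PosDef.transpose_eq {n : ℕ} {S : Matrix (Fin n) (Fin n) ℝ}
    (hS : S.PosDef) : Sᵀ = S := by
  have h := hS.isHermitian.eq
  rwa [Matrix.conjTranspose_eq_transpose_of_trivial] at h

theorem Matrix.dotProduct_mul_transpose_mulVec {n : ℕ} (R : Matrix (Fin n) (Fin n) ℝ)
    (a b : Fin n → ℝ) : a ⬝ᵥ ((R * Rᵀ) *ᵥ b) = (Rᵀ *ᵥ a) ⬝ᵥ (Rᵀ *ᵥ b) := by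
  rw [← Matrix.mulVec_mulVec, Matrix.dotProduct_mulVec, ← Matrix.mulVec_transpose]

theorem Matrix.mul_mul_transpose_apply_self {n : ℕ} (K S G : Matrix (Fin n) (Fin n) ℝ) (i : Fin n) :
    (K * S * Gᵀ) i i = K i ⬝ᵥ (S *ᵥ G i) := by
  rw [Matrix.mul_assoc, Matrix.mul_apply_eq_vecMul, Matrix.dotProduct_mulVec,
    ← Matrix.vecMul_vecMul]
  rfl

theorem dotProduct_sq_le {n : ℕ} (a b : Fin n → ℝ) : (a ⬝ᵥ b) ^ 2 ≤ (a ⬝ᵥ a) * (b ⬝ᵥ b) := by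
  simp only [dotProduct, ← sq]
  exact Finset.sum_mul_sq_le_sq_mul_sq _ _ _

/-- The Cauchy–Schwarz inequality for the inner product of a positive definite matrix. -/
theorem Matrix.PosDef.dotProduct_mulVec_sq_le {n : ℕ} {S : Matrix (Fin n) (Fin n) ℝ}
    (hS : S.PosDef) (a b : Fin n → ℝ) :
    (a ⬝ᵥ (S *ᵥ b)) ^ 2 ≤ (a ⬝ᵥ (S *ᵥ a)) * (b ⬝ᵥ (S *ᵥ b)) := by
  obtain ⟨R, rfl, -⟩ := hS.exists_eq_mul_transpose
  simp only [Matrix.dotProduct_mul_transpose_mulVec]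
  exact dotProduct_sq_le _ _

theorem Matrix.PosDef.quadratic_nonneg {n : ℕ} {S : Matrix (Fin n) (Fin n) ℝ}
    (hS : S.PosDef) (v : Fin n → ℝ) : 0 ≤ v ⬝ᵥ (S *ᵥ v) := by
  simpa using hS.posSemidef.dotProduct_mulVec_nonneg v

theorem Matrix.PosDef.isUnit_det {n : ℕ} {S : Matrix (Fin n) (Fin n) ℝ}
    (hS : S.PosDef) : IsUnit S.det := hS.det_pos.ne'.isUnit

/-- In the inner product defined by `S`, the coordinate `v j` is the product of `S⁻¹ e_j` with `v`,
and `S⁻¹ e_j` has squared length `S⁻¹ j j`; Cauchy–Schwarz concludes. -/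
theorem Matrix.PosDef.sq_apply_le {n : ℕ} {S : Matrix (Fin n) (Fin n) ℝ}
    (hS : S.PosDef) (v : Fin n → ℝ) (j : Fin n) : v j ^ 2 ≤ S⁻¹ j j * (v ⬝ᵥ (S *ᵥ v)) := by
  have hQ : S⁻¹ᵀ = S⁻¹ := hS.inv.transpose_eq
  have h := hS.dotProduct_mulVec_sq_le (S⁻¹ *ᵥ Pi.single j 1) v
  have h1 : ∀ w : Fin n → ℝ, (S⁻¹ *ᵥ Pi.single j 1) ⬝ᵥ (S *ᵥ w) = w j := by
    intro w
    rw [Matrix.dotProduct_mulVec, ← Matrix.mulVec_transpose, hS.transpose_eq,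
      Matrix.mulVec_mulVec, Matrix.mul_nonsing_inv _ hS.isUnit_det, Matrix.one_mulVec,
      single_one_dotProduct]
  rw [h1, h1] at h
  simpa using h

theorem Matrix.PosDef.dotProduct_self_le {n : ℕ} {S : Matrix (Fin n) (Fin n) ℝ}
    (hS : S.PosDef) (v : Fin n → ℝ) : v ⬝ᵥ v ≤ S⁻¹.trace * (v ⬝ᵥ (S *ᵥ v)) := by
  simp only [dotProduct.eq_1 v v, Matrix.trace, Matrix.diag_apply, Finset.sum_mul]
  refine Finset.sum_le_sum fun j _ => ?_
  rw [← sq]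
  exact hS.sq_apply_le v j

/-- With `S = R Rᵀ` the form is `|Rᵀ v|²`. Cauchy–Schwarz bounds each coordinate by the length of a
column of `R`, and the squared column lengths add up to `Tr S`. -/
theorem Matrix.PosDef.quadratic_le_trace_mul {n : ℕ} {S : Matrix (Fin n) (Fin n) ℝ}
    (hS : S.PosDef) (v : Fin n → ℝ) : v ⬝ᵥ (S *ᵥ v) ≤ S.trace * (v ⬝ᵥ v) := by
  obtain ⟨R, rfl, -⟩ := hS.exists_eq_mul_transpose
  rw [Matrix.dotProduct_mul_transpose_mulVec, Matrix.trace_mul_comm]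
  simp only [Matrix.trace, Matrix.diag_apply, Finset.sum_mul]
  rw [dotProduct.eq_1 (Rᵀ *ᵥ v)]
  refine Finset.sum_le_sum fun k _ => ?_
  rw [← sq]
  exact dotProduct_sq_le _ _

/-- `Tr (Q K S Kᵀ) ≤ Tr Q * Tr (K S Kᵀ)` for positive definite `Q` and `S`. -/
theorem Matrix.PosDef.trace_mul_conj_le {n : ℕ} {Q S : Matrix (Fin n) (Fin n) ℝ}
    (hQ : Q.PosDef) (hS : S.PosDef) (K : Matrix (Fin n) (Fin n) ℝ) :
    (Q * (K * S * Kᵀ)).trace ≤ Q.trace * (K * S * Kᵀ).trace := by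
  obtain ⟨R, rfl, -⟩ := hS.exists_eq_mul_transpose
  have h : K * (R * Rᵀ) * Kᵀ = (K * R) * (K * R)ᵀ := by
    rw [Matrix.transpose_mul]; simp only [Matrix.mul_assoc]
  -- Both traces become sums over the columns of `N = K R`, so the bound for quadratic forms applies
  -- column by column.
  rw [h, ← Matrix.mul_assoc, Matrix.trace_mul_comm, Matrix.trace_mul_comm (K * R)]
  set N := K * R
  simp only [Matrix.trace, Matrix.diag_apply, Finset.mul_sum]
  refine Finset.sum_le_sum fun k _ => ?_
  exact hQ.quadratic_le_trace_mul fun i => N i k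

/-- The algebraic inequality behind the upper bound of the information rate. -/
theorem Matrix.PosDef.rate_inequality {n : ℕ} {S : Matrix (Fin n) (Fin n) ℝ} (hS : S.PosDef)
    (K : Matrix (Fin n) (Fin n) ℝ) (w d : Fin n → ℝ) (hd : ∀ i, 0 < d i) :
    w ⬝ᵥ (S⁻¹ *ᵥ w) + ((K * K).trace + (S⁻¹ * (K * S * Kᵀ)).trace) ≤
      S⁻¹.trace * (∑ i, (w i ^ 2 + (K * S * Kᵀ) i i) / d i) * (∑ i, d i) + ∑ i, K i i ^ 2 := by
  set τ := S⁻¹.trace with hτ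
  set M : Fin n → ℝ := fun i => (K * S * Kᵀ) i i with hM
  have hτ0 : 0 ≤ τ := hS.inv.posSemidef.trace_nonneg
  have hMq : ∀ i, M i = K i ⬝ᵥ (S *ᵥ K i) := K.mul_mul_transpose_apply_self S K
  have hK : ∀ i j, K i j ^ 2 ≤ τ * M i := fun i j => by
    rw [hMq]
    refine (hS.sq_apply_le (K i) j).trans
      (mul_le_mul_of_nonneg_right ?_ (hS.quadratic_nonneg _))
    exact Finset.single_le_sum (f := fun j => S⁻¹ j j)
      (fun j _ => hS.inv.posSemidef.diag_nonneg) (Finset.mem_univ j)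
  have hw : w ⬝ᵥ (S⁻¹ *ᵥ w) ≤ τ * (∑ i, w i ^ 2 / d i) * (∑ i, d i) := by
    refine (hS.inv.quadratic_le_trace_mul w).trans ?_
    rw [mul_assoc]
    refine mul_le_mul_of_nonneg_left ?_ hτ0
    rw [Finset.sum_mul, dotProduct]
    refine Finset.sum_le_sum fun i _ => ?_
    have h1 : d i ≤ ∑ j, d j :=
      Finset.single_le_sum (f := d) (fun j _ => (hd j).le) (Finset.mem_univ i)
    rw [div_mul_eq_mul_div, le_div_iff₀ (hd i), ← sq]
    exact mul_le_mul_of_nonneg_left h1 (sq_nonneg _)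
  have hQ : (S⁻¹ * (K * S * Kᵀ)).trace ≤ τ * ∑ i, M i := hS.inv.trace_mul_conj_le hS K
  -- Only off-diagonal terms survive on either side. The array `b` is not symmetric, so `a` is
  -- compared with its symmetrization, which has the same sum.
  have hT : (K * K).trace - ∑ i, K i i ^ 2 ≤
      τ * ((∑ i, M i / d i) * (∑ j, d j)) - τ * ∑ i, M i := by
    let a : Fin n → Fin n → ℝ := fun i j => K i j * K j i - if i = j then K i i ^ 2 else 0
    let b : Fin n → Fin n → ℝ := fun i j =>
      τ * (M i / d i * d j) - if i = j then τ * M i else 0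
    have ha : (K * K).trace - ∑ i, K i i ^ 2 = ∑ i, ∑ j, a i j := by
      simp [a, Matrix.trace, Matrix.mul_apply, Finset.sum_sub_distrib]
    have hb : τ * ((∑ i, M i / d i) * (∑ j, d j)) - τ * ∑ i, M i = ∑ i, ∑ j, b i j := by
      simp only [b, Finset.sum_sub_distrib, Finset.sum_ite_eq, Finset.mem_univ, if_true,
        ← Finset.mul_sum, ← Finset.sum_mul]
    have hab : ∀ i j, a i j ≤ (b i j + b j i) / 2 := by
      intro i j
      by_cases hij : i = j
      · subst hij
        have := hd i
        simp only [a, b, if_true]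
        rw [div_mul_cancel₀ _ this.ne']
        linarith [sq (K i i)]
      · have hji : ¬ j = i := fun h => hij h.symm
        simp only [a, b, if_neg hij, if_neg hji, sub_zero]
        have h1 := mul_le_mul_of_nonneg_right (hK i j) (div_pos (hd j) (hd i)).le
        have h2 := mul_le_mul_of_nonneg_right (hK j i) (div_pos (hd i) (hd j)).le
        -- AM–GM with weights `d j / d i` and `d i / d j`, chosen so that `K i j ^ 2 ≤ τ * M i`
        -- produces exactly the terms of `b`.
        have h3 : K i j * K j i ≤
            (K i j ^ 2 * (d j / d i) + K j i ^ 2 * (d i / d j)) / 2 := by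
          have := hd i
          have := hd j
          have h4 : (K i j ^ 2 * (d j / d i) + K j i ^ 2 * (d i / d j)) / 2 - K i j * K j i =
              (d j * K i j - d i * K j i) ^ 2 / (2 * d i * d j) := by
            field_simp
            ring
          have h5 : 0 ≤ (d j * K i j - d i * K j i) ^ 2 / (2 * d i * d j) := by positivity
          linarith
        calc K i j * K j i ≤ _ := h3
          _ ≤ (τ * M i * (d j / d i) + τ * M j * (d i / d j)) / 2 := by linarith
          _ = _ := by ring
    rw [ha, hb]
    calc ∑ i, ∑ j, a i j ≤ ∑ i, ∑ j, (b i j + b j i) / 2 :=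
          Finset.sum_le_sum fun i _ => Finset.sum_le_sum fun j _ => hab i j
      _ = (∑ i, ∑ j, b i j + ∑ i, ∑ j, b j i) / 2 := by
          simp only [← Finset.sum_div, Finset.sum_add_distrib]
      _ = _ := by rw [Finset.sum_comm (f := fun i j => b j i)]; ring
  have hsum : ∑ i, (w i ^ 2 + M i) / d i = ∑ i, w i ^ 2 / d i + ∑ i, M i / d i := by
    simp only [add_div, Finset.sum_add_distrib]
  rw [hsum]
  linarith

/-- The square of a sum in terms of `pairSum`. -/
theorem sum_sq_eq_sq_sub_pairSum {n : ℕ} (s : Fin n → ℝ) :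
    (∑ i, s i) ^ 2 - 2 * pairSum s = ∑ i, s i ^ 2 := by
  have h1 : (∑ i, s i) ^ 2 = ∑ q : Fin n × Fin n, s q.1 * s q.2 := by
    rw [sq, Finset.sum_mul_sum, Fintype.sum_prod_type]
  have h2 : ∀ q : Fin n × Fin n, s q.1 * s q.2 =
      ((if q.1 < q.2 then s q.1 * s q.2 else 0) + (if q.2 < q.1 then s q.1 * s q.2 else 0)) +
        (if q.1 = q.2 then s q.1 * s q.2 else 0) := by
    intro q
    rcases lt_trichotomy q.1 q.2 with h | h | h
    · simp [h, h.ne, h.not_gt]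
    · simp [h]
    · simp [h, h.ne', h.not_gt]
  have h3 : ∑ q : Fin n × Fin n, (if q.2 < q.1 then s q.1 * s q.2 else 0) = pairSum s := by
    rw [pairSum, Finset.sum_filter, ← Equiv.sum_comp (Equiv.prodComm (Fin n) (Fin n))]
    exact Finset.sum_congr rfl fun q _ => by simp [mul_comm]
  have h4 : ∑ q : Fin n × Fin n, (if q.1 = q.2 then s q.1 * s q.2 else 0) = ∑ i, s i ^ 2 := by
    simp [Fintype.sum_prod_type, sq]
  rw [h1, Finset.sum_congr rfl fun q _ => h2 q, Finset.sum_add_distrib, Finset.sum_add_distrib,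
    h3, h4, pairSum, Finset.sum_filter]
  ring

/-! ### Gaussian densities: integrability and total mass -/

/-- The norm on `Fin n → ℝ` is the sup norm, so only an inequality holds; it suffices for tail
bounds. -/
theorem norm_sq_le_dotProduct_self {n : ℕ} (v : Fin n → ℝ) : ‖v‖ ^ 2 ≤ v ⬝ᵥ v := by
  have h0 : 0 ≤ v ⬝ᵥ v := by simpa using dotProduct_star_self_nonneg v
  have h : ‖v‖ ≤ √(v ⬝ᵥ v) := by
    refine (pi_norm_le_iff_of_nonneg (Real.sqrt_nonneg _)).2 fun i => ?_
    rw [Real.norm_eq_abs]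
    refine Real.abs_le_sqrt ?_
    rw [sq]
    exact Finset.single_le_sum (f := fun i => v i * v i) (fun i _ => mul_self_nonneg _)
      (Finset.mem_univ i)
  calc ‖v‖ ^ 2 ≤ √(v ⬝ᵥ v) ^ 2 := by gcongr
    _ = _ := Real.sq_sqrt h0

/-- From `1 + r ≤ exp r`; completing the square gives `N r - c r² ≤ N² / (4c)`. -/
theorem one_add_pow_mul_exp_neg_le {c : ℝ} (hc : 0 < c) (N : ℕ) {r : ℝ} (hr : 0 ≤ r) :
    (1 + r) ^ N * Real.exp (-c * r ^ 2) ≤ Real.exp (N ^ 2 / (4 * c)) := by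
  have h1 : (1 + r) ^ N ≤ Real.exp (N * r) := by
    rw [Real.exp_nat_mul]
    refine pow_le_pow_left₀ (by positivity) ?_ N
    linarith [Real.add_one_le_exp r]
  calc (1 + r) ^ N * Real.exp (-c * r ^ 2)
      ≤ Real.exp (N * r) * Real.exp (-c * r ^ 2) := by gcongr
    _ = Real.exp (N * r + -c * r ^ 2) := (Real.exp_add _ _).symm
    _ ≤ _ := by
      refine Real.exp_le_exp.2 ?_
      rw [le_div_iff₀ (by positivity)]
      nlinarith [sq_nonneg (2 * c * r - N)]

theorem integrable_one_add_norm_pow_mul_exp_neg {n : ℕ} {c : ℝ} (hc : 0 < c) (k : ℕ) :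
    Integrable fun y : Fin n → ℝ => (1 + ‖y‖) ^ k * Real.exp (-c * ‖y‖ ^ 2) := by
  -- The integrable majorant is a multiple of `(1 + ‖y‖)^(-(n+1))`; its exponent exceeds the
  -- dimension, and the exponential absorbs the `n + 1` extra powers.
  have h := (integrable_one_add_norm (E := Fin n → ℝ) (μ := volume) (r := (n + 1 : ℕ))
    (by simp)).const_mul (Real.exp ((k + (n + 1) : ℕ) ^ 2 / (4 * c)))
  refine h.mono' (by fun_prop) (Filter.Eventually.of_forall fun y => ?_)
  have hy : 0 < 1 + ‖y‖ := by positivity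
  rw [Real.norm_of_nonneg (by positivity), Real.rpow_neg hy.le, Real.rpow_natCast, ← div_eq_mul_inv,
    le_div_iff₀ (by positivity)]
  refine le_trans (le_of_eq ?_) (one_add_pow_mul_exp_neg_le hc (k + (n + 1)) (norm_nonneg y))
  rw [pow_add]
  ring

theorem gaussianDensity_pos {n : ℕ} {S : Matrix (Fin n) (Fin n) ℝ} (hS : S.PosDef)
    (m x : Fin n → ℝ) : 0 < gaussianDensity m S x := by
  have h : 0 < ((2 * Real.pi) • S).det := by
    rw [Matrix.det_smul]
    exact mul_pos (by positivity) hS.det_pos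
  unfold gaussianDensity
  positivity

theorem log_gaussianDensity {n : ℕ} {S : Matrix (Fin n) (Fin n) ℝ} (hS : S.PosDef)
    (m x : Fin n → ℝ) : Real.log (gaussianDensity m S x) =
      -(1 / 2) * (n * Real.log (2 * Real.pi) + Real.log S.det)
        - 1 / 2 * ((x - m) ⬝ᵥ (S⁻¹ *ᵥ (x - m))) := by
  have h2 : (0 : ℝ) < (2 * Real.pi) ^ n := by positivity
  have h : 0 < ((2 * Real.pi) • S).det := by
    rw [Matrix.det_smul]
    exact mul_pos (by positivity) hS.det_pos
  rw [gaussianDensity, Real.log_mul (by positivity) (Real.exp_ne_zero _), Real.log_exp, one_div,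
    Real.log_inv, Real.log_sqrt h.le, Matrix.det_smul, Fintype.card_fin,
    Real.log_mul h2.ne' hS.det_pos.ne', Real.log_pow]
  ring

/-- Functions of temperate growth are integrable against Gaussian densities. -/
theorem Function.HasTemperateGrowth.integrable_mul_gaussianDensity {n : ℕ}
    {S : Matrix (Fin n) (Fin n) ℝ} (hS : S.PosDef) (m : Fin n → ℝ) {F : (Fin n → ℝ) → ℝ}
    (hF : F.HasTemperateGrowth) : Integrable fun x => F x * gaussianDensity m S x := by
  -- In dimension `0` the trace of `S` vanishes and the rate `c` below would not be positive.
  rcases isEmpty_or_nonempty (Fin n) with hn | hn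
  · exact Integrable.of_finite
  have hG : (fun y => F (y + m)).HasTemperateGrowth :=
    hF.comp (Function.HasTemperateGrowth.id'.add (.const m))
  obtain ⟨k, C, hC⟩ := hG.2 0
  have hτ : 0 < S.trace := hS.trace_pos
  -- This rate comes from `‖y‖² ≤ Tr S * (y · S⁻¹y)`, which gives `c ‖y‖² ≤ (y · S⁻¹y) / 2`.
  set c : ℝ := 1 / (2 * S.trace)
  have hc : 0 < c := by positivity
  have hcont : Continuous fun y => F (y + m) := hG.1.continuous
  set A : ℝ := 1 / √(((2 * Real.pi) • S).det)
  have hA : 0 ≤ A := by positivity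
  have key : Integrable fun y => F (y + m) *
      (A * Real.exp (-(1 / 2) * (y ⬝ᵥ (S⁻¹ *ᵥ y)))) := by
    refine ((integrable_one_add_norm_pow_mul_exp_neg hc k).const_mul (C * A)).mono' ?_
      (Filter.Eventually.of_forall fun y => ?_)
    · refine Continuous.aestronglyMeasurable ?_
      have : Continuous fun y : Fin n → ℝ => y ⬝ᵥ (S⁻¹ *ᵥ y) := by fun_prop
      exact hcont.mul (continuous_const.mul (Real.continuous_exp.comp (continuous_const.mul this)))
    · have h1 : ‖F (y + m)‖ ≤ C * (1 + ‖y‖) ^ k := by simpa using hC y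
      have h2 : Real.exp (-(1 / 2) * (y ⬝ᵥ (S⁻¹ *ᵥ y))) ≤ Real.exp (-c * ‖y‖ ^ 2) := by
        refine Real.exp_le_exp.2 ?_
        have h3 := (norm_sq_le_dotProduct_self y).trans (hS.inv.dotProduct_self_le y)
        rw [Matrix.nonsing_inv_nonsing_inv _ hS.isUnit_det] at h3
        have h4 : c * ‖y‖ ^ 2 ≤ c * (S.trace * (y ⬝ᵥ (S⁻¹ *ᵥ y))) :=
          mul_le_mul_of_nonneg_left h3 hc.le
        have h5 : c * (S.trace * (y ⬝ᵥ (S⁻¹ *ᵥ y))) = 1 / 2 * (y ⬝ᵥ (S⁻¹ *ᵥ y)) := by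
          simp only [c]
          field_simp
        linarith
      rw [norm_mul, Real.norm_of_nonneg (r := A * _) (by positivity)]
      calc ‖F (y + m)‖ * (A * Real.exp (-(1 / 2) * (y ⬝ᵥ (S⁻¹ *ᵥ y))))
          ≤ (C * (1 + ‖y‖) ^ k) * (A * Real.exp (-c * ‖y‖ ^ 2)) := by
            gcongr
            exact (norm_nonneg _).trans h1
        _ = _ := by ring
  simpa [gaussianDensity, A] using key.comp_sub_right m

/-- The substitution `x = m + R z` with `S = R Rᵀ` turns the exponent into `-|z|²/2`, so the
integral factors into one-dimensional Gaussians; the Jacobian `|det R|` cancels `√(det S)`. -/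
theorem integral_gaussianDensity {n : ℕ} {S : Matrix (Fin n) (Fin n) ℝ} (hS : S.PosDef)
    (m : Fin n → ℝ) : ∫ x, gaussianDensity m S x = 1 := by
  obtain ⟨R, hR, hdet⟩ := hS.exists_eq_mul_transpose
  have hRt : IsUnit Rᵀ.det := by rw [Matrix.det_transpose]; exact hdet.isUnit
  set f : (Fin n → ℝ) → ℝ := fun y => Real.exp (-(1 / 2) * (y ⬝ᵥ (S⁻¹ *ᵥ y)))
  have hf : Continuous f := by
    have : Continuous fun y : Fin n → ℝ => y ⬝ᵥ (S⁻¹ *ᵥ y) := by fun_prop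
    fun_prop
  have hfR : ∀ z, f (Matrix.toLin' R z) = ∏ i, Real.exp (-(1 / 2) * z i ^ 2) := by
    intro z
    have h : (R *ᵥ z) ⬝ᵥ (S⁻¹ *ᵥ (R *ᵥ z)) = z ⬝ᵥ z := by
      rw [hR, Matrix.mul_inv_rev, Matrix.mulVec_mulVec, Matrix.mul_assoc,
        Matrix.nonsing_inv_mul _ hdet.isUnit, Matrix.mul_one, ← Matrix.vecMul_transpose,
        ← Matrix.dotProduct_mulVec, Matrix.mulVec_mulVec, Matrix.mul_nonsing_inv _ hRt,
        Matrix.one_mulVec]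
    simp only [f, Matrix.toLin'_apply, h]
    rw [← Real.exp_sum, ← Finset.mul_sum, dotProduct]
    simp only [sq]
  have h1 : ∫ z, f (Matrix.toLin' R z) = (2 * Real.pi) ^ ((n : ℝ) / 2) := by
    simp only [hfR]
    rw [volume_pi, integral_fintype_prod_eq_pow (fun z : ℝ => Real.exp (-(1 / 2) * z ^ 2)), integral_gaussian,
      Fintype.card_fin, Real.sqrt_eq_rpow, ← Real.rpow_natCast, ← Real.rpow_mul (by positivity)]
    congr 1 <;> ring
  have h2 : ∫ z, f (Matrix.toLin' R z) = |R.det|⁻¹ * ∫ y, f y := by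
    have hm : AEMeasurable (Matrix.toLin' R) (volume : Measure (Fin n → ℝ)) :=
      (LinearMap.continuous_of_finiteDimensional _).measurable.aemeasurable
    rw [← integral_map hm hf.aestronglyMeasurable, Real.map_matrix_volume_pi_eq_smul_volume_pi hdet,
      integral_smul_measure, ENNReal.toReal_ofReal (abs_nonneg _), abs_inv, smul_eq_mul]
  have h3 : ∫ y, f y = |R.det| * (2 * Real.pi) ^ ((n : ℝ) / 2) := by
    rw [← h1, h2, mul_inv_cancel_left₀ (abs_ne_zero.2 hdet)]
  have h4 : √(((2 * Real.pi) • S).det) = |R.det| * (2 * Real.pi) ^ ((n : ℝ) / 2) := by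
    rw [Matrix.det_smul, hR, Matrix.det_mul, Matrix.det_transpose, Real.sqrt_mul (by positivity),
      Real.sqrt_mul_self_eq_abs, Fintype.card_fin, mul_comm, Real.sqrt_eq_rpow,
      ← Real.rpow_natCast, ← Real.rpow_mul (by positivity)]
    congr 2
    ring
  have h5 : ∀ x, gaussianDensity m S x = 1 / √(((2 * Real.pi) • S).det) * f (x - m) :=
    fun x => rfl
  simp only [h5]
  rw [integral_const_mul, integral_sub_right_eq_self f, h3, h4, one_div]
  have : 0 < |R.det| := abs_pos.2 hdet
  exact inv_mul_cancel₀ (by positivity)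

/-! ### Temperate growth and directional derivatives -/

namespace Function.HasTemperateGrowth

variable {E : Type*} [NormedAddCommGroup E] [NormedSpace ℝ E] {n : ℕ}

theorem pi_apply {f : E → Fin n → ℝ} (hf : f.HasTemperateGrowth) (i : Fin n) :
    (fun x => f x i).HasTemperateGrowth :=
  (ContinuousLinearMap.proj (R := ℝ) (φ := fun _ : Fin n => ℝ) i).hasTemperateGrowth.comp hf

theorem dotProduct {f g : E → Fin n → ℝ} (hf : f.HasTemperateGrowth)
    (hg : g.HasTemperateGrowth) : (fun x => f x ⬝ᵥ g x).HasTemperateGrowth :=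
  Function.HasTemperateGrowth.sum fun i _ => (hf.pi_apply i).mul (hg.pi_apply i)

theorem mulVec {f : E → Fin n → ℝ} (hf : f.HasTemperateGrowth) (A : Matrix (Fin n) (Fin n) ℝ) :
    (fun x => A *ᵥ f x).HasTemperateGrowth :=
  (Matrix.mulVecLin A).toContinuousLinearMap.hasTemperateGrowth.comp hf

end Function.HasTemperateGrowth

theorem hasTemperateGrowth_sub_const {n : ℕ} (m : Fin n → ℝ) :
    (fun x : Fin n → ℝ => x - m).HasTemperateGrowth :=
  Function.HasTemperateGrowth.id'.sub (.const m)

theorem HasLineDerivAt.mul {n : ℕ} {f g : (Fin n → ℝ) → ℝ} {f' g' : ℝ} {x v : Fin n → ℝ}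
    (hf : HasLineDerivAt ℝ f f' x v) (hg : HasLineDerivAt ℝ g g' x v) :
    HasLineDerivAt ℝ (fun y => f y * g y) (f' * g x + f x * g') x v := by
  have h : HasDerivAt (fun t : ℝ => f (x + t • v) * g (x + t • v))
      (f' * g (x + (0 : ℝ) • v) + f (x + (0 : ℝ) • v) * g') 0 := HasDerivAt.mul hf hg
  rwa [zero_smul, add_zero] at h

theorem hasLineDerivAt_const_add_dotProduct_sub {n : ℕ} (α : ℝ) (a m x v : Fin n → ℝ) :
    HasLineDerivAt ℝ (fun y => α + a ⬝ᵥ (y - m)) (a ⬝ᵥ v) x v := by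
  have h : ∀ t : ℝ, α + a ⬝ᵥ (x + t • v - m) = t * (a ⬝ᵥ v) + (α + a ⬝ᵥ (x - m)) := by
    intro t
    rw [add_sub_right_comm, dotProduct_add, dotProduct_smul, smul_eq_mul]
    ring
  simp only [HasLineDerivAt, h]
  simpa using ((hasDerivAt_id (0 : ℝ)).mul_const (a ⬝ᵥ v)).add_const (α + a ⬝ᵥ (x - m))

theorem hasLineDerivAt_quadratic {n : ℕ} (G : Matrix (Fin n) (Fin n) ℝ) (m x v : Fin n → ℝ) :
    HasLineDerivAt ℝ (fun y => (y - m) ⬝ᵥ (G *ᵥ (y - m)))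
      (v ⬝ᵥ ((Gᵀ + G) *ᵥ (x - m))) x v := by
  set y := x - m
  have h : ∀ t : ℝ, (x + t • v - m) ⬝ᵥ (G *ᵥ (x + t • v - m)) =
      t * (v ⬝ᵥ ((Gᵀ + G) *ᵥ y)) + t ^ 2 * (v ⬝ᵥ (G *ᵥ v)) + y ⬝ᵥ (G *ᵥ y) := by
    intro t
    have h1 : y ⬝ᵥ (G *ᵥ v) = v ⬝ᵥ (Gᵀ *ᵥ y) := by
      rw [Matrix.dotProduct_mulVec, ← Matrix.mulVec_transpose, dotProduct_comm]
    rw [add_sub_right_comm, Matrix.mulVec_add, Matrix.mulVec_smul, dotProduct_add, add_dotProduct,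
      add_dotProduct, dotProduct_smul, smul_dotProduct, smul_dotProduct, dotProduct_smul,
      Matrix.add_mulVec, dotProduct_add]
    simp only [smul_eq_mul]
    rw [h1]
    ring
  simp only [HasLineDerivAt, h]
  have h2 := (((hasDerivAt_id (0 : ℝ)).mul_const (v ⬝ᵥ ((Gᵀ + G) *ᵥ y))).add
    (((hasDerivAt_id (0 : ℝ)).pow 2).mul_const (v ⬝ᵥ (G *ᵥ v)))).add_const (y ⬝ᵥ (G *ᵥ y))
  simpa using h2

theorem hasLineDerivAt_gaussianDensity {n : ℕ} {S : Matrix (Fin n) (Fin n) ℝ} (hS : S.PosDef)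
    (m x v : Fin n → ℝ) : HasLineDerivAt ℝ (gaussianDensity m S)
      (-(v ⬝ᵥ (S⁻¹ *ᵥ (x - m))) * gaussianDensity m S x) x v := by
  have h := hasLineDerivAt_quadratic S⁻¹ m x v
  rw [hS.inv.transpose_eq, ← two_smul ℝ, Matrix.smul_mulVec, dotProduct_smul, smul_eq_mul] at h
  have h1 := ((HasDerivAt.const_mul (-(1 / 2)) h).exp).const_mul (1 / √(((2 * Real.pi) • S).det))
  unfold HasLineDerivAt
  convert! h1 using 1
  simp only [gaussianDensity, zero_smul, add_zero]
  ring

theorem hasLineDerivAt_log_gaussianDensity {n : ℕ} {S : Matrix (Fin n) (Fin n) ℝ} (hS : S.PosDef)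
    (m x v : Fin n → ℝ) : HasLineDerivAt ℝ (fun y => Real.log (gaussianDensity m S y))
      (-(v ⬝ᵥ (S⁻¹ *ᵥ (x - m)))) x v := by
  have h := HasDerivAt.log (hasLineDerivAt_gaussianDensity hS m x v)
    (by simpa using (gaussianDensity_pos hS m x).ne')
  unfold HasLineDerivAt
  convert! h using 1
  rw [zero_smul, add_zero, mul_div_cancel_right₀ _ (gaussianDensity_pos hS m x).ne']

theorem hasTemperateGrowth_log_gaussianDensity {n : ℕ} {S : Matrix (Fin n) (Fin n) ℝ}
    (hS : S.PosDef) (m : Fin n → ℝ) :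
    (fun x => Real.log (gaussianDensity m S x)).HasTemperateGrowth := by
  simp only [log_gaussianDensity hS]
  exact (Function.HasTemperateGrowth.const _).sub ((Function.HasTemperateGrowth.const _).mul
    ((hasTemperateGrowth_sub_const m).dotProduct ((hasTemperateGrowth_sub_const m).mulVec _)))

theorem hasTemperateGrowth_const_add_dotProduct_sub {n : ℕ} (α : ℝ) (a m : Fin n → ℝ) :
    (fun y => α + a ⬝ᵥ (y - m)).HasTemperateGrowth :=
  (Function.HasTemperateGrowth.const _).add
    ((Function.HasTemperateGrowth.const _).dotProduct (hasTemperateGrowth_sub_const m))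

/-! ### Stein's identity and Gaussian moments -/

theorem Matrix.PosDef.dotProduct_inv_mulVec {n : ℕ} {S : Matrix (Fin n) (Fin n) ℝ}
    (hS : S.PosDef) (v y : Fin n → ℝ) : v ⬝ᵥ (S⁻¹ *ᵥ y) = (S⁻¹ *ᵥ v) ⬝ᵥ y := by
  rw [Matrix.dotProduct_mulVec, ← Matrix.mulVec_transpose, hS.inv.transpose_eq]

/-- Integration by parts against a Gaussian density (Stein's identity). -/
theorem integral_mul_gaussianDensity_eq {n : ℕ} {S : Matrix (Fin n) (Fin n) ℝ} (hS : S.PosDef)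
    (m v : Fin n → ℝ) {F F' : (Fin n → ℝ) → ℝ} (hF : F.HasTemperateGrowth)
    (hF' : F'.HasTemperateGrowth) (hd : ∀ x, HasLineDerivAt ℝ F (F' x) x v) :
    ∫ x, F' x * gaussianDensity m S x =
      ∫ x, F x * (v ⬝ᵥ (S⁻¹ *ᵥ (x - m))) * gaussianDensity m S x := by
  have hlin : (fun x => v ⬝ᵥ (S⁻¹ *ᵥ (x - m))).HasTemperateGrowth :=
    (Function.HasTemperateGrowth.const v).dotProduct ((hasTemperateGrowth_sub_const m).mulVec _)
  have h1 := (hF.mul hlin).integrable_mul_gaussianDensity hS m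
  have h := integral_bilinear_hasLineDerivAt_right_eq_neg_left_of_integrable
    (μ := volume) (v := v) (f := F) (f' := F') (g := gaussianDensity m S)
    (g' := fun x => -(v ⬝ᵥ (S⁻¹ *ᵥ (x - m))) * gaussianDensity m S x)
    (B := ContinuousLinearMap.mul ℝ ℝ)
    (by simpa using hF'.integrable_mul_gaussianDensity hS m)
    (by
      refine h1.neg.congr (Filter.Eventually.of_forall fun x => ?_)
      simp only [Pi.neg_apply, Pi.mul_apply, ContinuousLinearMap.mul_apply']
      ring)
    (by simpa using hF.integrable_mul_gaussianDensity hS m)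
    (fun x _ => hd x) (fun x _ => hasLineDerivAt_gaussianDensity hS m x v)
  simp only [ContinuousLinearMap.mul_apply'] at h
  rw [← neg_eq_iff_eq_neg, ← integral_neg] at h
  rw [← h]
  exact integral_congr_ae (Filter.Eventually.of_forall fun x => by simp only []; ring)

/-- Stein's identity for `F = 1` in the direction `v = S a`, chosen so that `v · S⁻¹(x - m) = a · (x
- m)`. -/
theorem integral_dotProduct_mul_gaussianDensity {n : ℕ} {S : Matrix (Fin n) (Fin n) ℝ}
    (hS : S.PosDef) (m a : Fin n → ℝ) :
    ∫ x, a ⬝ᵥ (x - m) * gaussianDensity m S x = 0 := by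
  have h := integral_mul_gaussianDensity_eq hS m (S *ᵥ a) (F := fun _ => 1) (F' := fun _ => 0)
    (.const 1) (.const 0) (fun x => by
      simpa [HasLineDerivAt] using hasDerivAt_const (0 : ℝ) (1 : ℝ))
  simp only [hS.dotProduct_inv_mulVec, Matrix.mulVec_mulVec,
    Matrix.nonsing_inv_mul _ hS.isUnit_det, Matrix.one_mulVec] at h
  simpa using h.symm

theorem integral_const_add_mul_dotProduct_mul_gaussianDensity {n : ℕ}
    {S : Matrix (Fin n) (Fin n) ℝ} (hS : S.PosDef) (m a b : Fin n → ℝ) (α : ℝ) :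
    ∫ x, (α + a ⬝ᵥ (x - m)) * (b ⬝ᵥ (x - m)) * gaussianDensity m S x = a ⬝ᵥ (S *ᵥ b) := by
  have h := integral_mul_gaussianDensity_eq hS m (S *ᵥ b) (F := fun x => α + a ⬝ᵥ (x - m))
    (F' := fun _ => a ⬝ᵥ (S *ᵥ b)) (hasTemperateGrowth_const_add_dotProduct_sub α a m) (.const _)
    (fun x => hasLineDerivAt_const_add_dotProduct_sub α a m x _)
  simp only [hS.dotProduct_inv_mulVec, Matrix.mulVec_mulVec,
    Matrix.nonsing_inv_mul _ hS.isUnit_det, Matrix.one_mulVec] at h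
  rw [← h, integral_const_mul, integral_gaussianDensity hS, mul_one]

/-- Second moments of affine functions of a Gaussian vector. -/
theorem integral_affine_mul_affine_mul_gaussianDensity {n : ℕ} {S : Matrix (Fin n) (Fin n) ℝ}
    (hS : S.PosDef) (m a b : Fin n → ℝ) (α β : ℝ) :
    ∫ x, (α + a ⬝ᵥ (x - m)) * (β + b ⬝ᵥ (x - m)) * gaussianDensity m S x =
      α * β + a ⬝ᵥ (S *ᵥ b) := by
  have ha := hasTemperateGrowth_const_add_dotProduct_sub α a m
  have hb := hasTemperateGrowth_const_add_dotProduct_sub 0 b m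
  simp only [zero_add] at hb
  have i1 := (ha.mul hb).integrable_mul_gaussianDensity hS m
  have i2 := (Function.HasTemperateGrowth.const β).integrable_mul_gaussianDensity hS m
  have i3 := (hasTemperateGrowth_const_add_dotProduct_sub 0 a m).integrable_mul_gaussianDensity hS m
  simp only [zero_add] at i3
  simp only [Pi.mul_apply] at i1
  have i4 : Integrable fun x => α * (β * gaussianDensity m S x) +
      β * (a ⬝ᵥ (x - m) * gaussianDensity m S x) := (i2.const_mul α).add (i3.const_mul β)
  have h : ∀ x, (α + a ⬝ᵥ (x - m)) * (β + b ⬝ᵥ (x - m)) * gaussianDensity m S x =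
      (α + a ⬝ᵥ (x - m)) * (b ⬝ᵥ (x - m)) * gaussianDensity m S x +
        (α * (β * gaussianDensity m S x) + β * (a ⬝ᵥ (x - m) * gaussianDensity m S x)) := by
    intro x
    ring
  simp only [h]
  rw [integral_add i1 i4,
    integral_add (i2.const_mul α) (i3.const_mul β),
    integral_const_add_mul_dotProduct_mul_gaussianDensity hS, integral_const_mul,
    integral_const_mul, integral_const_mul, integral_gaussianDensity hS,
    integral_dotProduct_mul_gaussianDensity hS]
  ring

/-- Integration by parts against a weighted Gaussian density. -/
theorem integral_lineDeriv_mul_gaussianDensity_mul {n : ℕ} {S : Matrix (Fin n) (Fin n) ℝ}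
    (hS : S.PosDef) (m v : Fin n → ℝ) {F F' h h' : (Fin n → ℝ) → ℝ} (hF : F.HasTemperateGrowth)
    (hF' : F'.HasTemperateGrowth) (hd : ∀ x, HasLineDerivAt ℝ F (F' x) x v)
    (hh : h.HasTemperateGrowth) (hh' : h'.HasTemperateGrowth)
    (hhd : ∀ x, HasLineDerivAt ℝ h (h' x) x v) :
    ∫ x, (F' x - F x * (v ⬝ᵥ (S⁻¹ *ᵥ (x - m)))) * gaussianDensity m S x * h x =
      -∫ x, F x * h' x * gaussianDensity m S x := by
  have hlin : (fun x => v ⬝ᵥ (S⁻¹ *ᵥ (x - m))).HasTemperateGrowth :=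
    (Function.HasTemperateGrowth.const v).dotProduct ((hasTemperateGrowth_sub_const m).mulVec _)
  -- Stein's identity for the product `F h`. In the goal, the bracket times the density is the
  -- derivative of `F` times the density along `v`.
  have h1 := integral_mul_gaussianDensity_eq hS m v (F := fun x => F x * h x)
    (F' := fun x => F' x * h x + F x * h' x) (hF.mul hh) ((hF'.mul hh).add (hF.mul hh'))
    (fun x => (hd x).mul (hhd x))
  have i1 := (hF'.mul hh).integrable_mul_gaussianDensity hS m
  have i2 := (hF.mul hh').integrable_mul_gaussianDensity hS m
  have i3 := ((hF.mul hh).mul hlin).integrable_mul_gaussianDensity hS m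
  simp only [Pi.mul_apply] at i1 i2 i3
  simp only [add_mul] at h1
  rw [integral_add i1 i2] at h1
  have h2 : ∀ x, (F' x - F x * (v ⬝ᵥ (S⁻¹ *ᵥ (x - m)))) * gaussianDensity m S x * h x =
      F' x * h x * gaussianDensity m S x -
        F x * h x * (v ⬝ᵥ (S⁻¹ *ᵥ (x - m))) * gaussianDensity m S x := by
    intro x
    ring
  simp only [h2]
  rw [integral_sub i1 i3, ← h1]
  ring

/-! ### Time derivatives of determinant, inverse and log-density -/

theorem hasDerivWithinAt_matrix {n : ℕ} {C : ℝ → Matrix (Fin n) (Fin n) ℝ}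
    {C' : Matrix (Fin n) (Fin n) ℝ} {s : Set ℝ} {t : ℝ} :
    HasDerivWithinAt C C' s t ↔ ∀ i j, HasDerivWithinAt (fun r => C r i j) (C' i j) s t := by
  refine (hasDerivWithinAt_pi (φ := C) (φ' := C')).trans (forall_congr' fun i => ?_)
  exact hasDerivWithinAt_pi (φ := fun r => C r i) (φ' := C' i)

/-- Jacobi's formula for the derivative of the determinant along a curve. -/
theorem HasDerivWithinAt.matrix_det {n : ℕ} {C : ℝ → Matrix (Fin n) (Fin n) ℝ}
    {C' : Matrix (Fin n) (Fin n) ℝ} {s : Set ℝ} {t : ℝ} (hC : HasDerivWithinAt C C' s t) :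
    HasDerivWithinAt (fun r => (C r).det) ((C t).adjugate * C').trace s t := by
  let f : ContinuousMultilinearMap ℝ (fun _ : Fin n => Fin n → ℝ) ℝ :=
    { toMultilinearMap := Matrix.detRowAlternating.toMultilinearMap
      cont := continuous_id.matrix_det }
  have hrow : ∀ i, HasDerivWithinAt (fun r => C r i) (C' i) s t :=
    hasDerivWithinAt_pi.1 hC
  have h := (HasFDerivWithinAt.multilinear_comp (f := f)
    (fun i => (hrow i).hasFDerivWithinAt)).hasDerivWithinAt
  -- Multilinearity in the rows yields determinants with one row replaced; Cramer's rule expands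
  -- each in cofactors.
  have h1 : ∀ i, Matrix.det (Function.update (C t) i (C' i)) =
      ∑ j, (C t).adjugate j i * C' i j := by
    intro i
    have h2 := Matrix.cramer_transpose_apply (C t) (C' i) i
    rw [Matrix.cramer_eq_adjugate_mulVec, ← Matrix.adjugate_transpose] at h2
    exact h2.symm
  have h3 : ((C t).adjugate * C').trace = ∑ i, Matrix.det (Function.update (C t) i (C' i)) := by
    simp only [h1, Matrix.trace, Matrix.diag_apply, Matrix.mul_apply]
    exact Finset.sum_comm
  rw [h3]
  convert! h using 1
  simp only [sum_apply, ContinuousLinearMap.comp_apply]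
  refine Finset.sum_congr rfl fun i _ => ?_
  simp [f, ContinuousMultilinearMap.toContinuousLinearMap]
  rfl

-- Matrices with the operator norm form a Banach algebra, where inversion has derivative `H ↦ -C⁻¹ H
-- C⁻¹` at an invertible `C`.
open scoped Matrix.Norms.Operator in
theorem HasDerivWithinAt.matrix_inv {n : ℕ} {C : ℝ → Matrix (Fin n) (Fin n) ℝ}
    {C' : Matrix (Fin n) (Fin n) ℝ} {s : Set ℝ} {t : ℝ} (hC : HasDerivWithinAt C C' s t)
    (hu : IsUnit (C t)) :
    HasDerivWithinAt (fun r => (C r)⁻¹) (-((C t)⁻¹ * C' * (C t)⁻¹)) s t := by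
  obtain ⟨U, hU⟩ := hu
  have h := hasFDerivAt_ringInverse (𝕜 := ℝ) U
  rw [hU] at h
  have h1 := h.comp_hasDerivWithinAt t hC
  have h2 : ((U⁻¹ : (Matrix (Fin n) (Fin n) ℝ)ˣ) : Matrix (Fin n) (Fin n) ℝ) = (C t)⁻¹ := by
    rw [← hU, Matrix.coe_units_inv]
  simp only [Function.comp_def, h2, ← Matrix.nonsing_inv_eq_ringInverse, _root_.neg_apply,
    ContinuousLinearMap.mulLeftRight_apply] at h1
  exact h1

theorem HasDerivWithinAt.dotProduct {n : ℕ} {a b : ℝ → Fin n → ℝ} {a' b' : Fin n → ℝ}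
    {s : Set ℝ} {t : ℝ} (ha : HasDerivWithinAt a a' s t) (hb : HasDerivWithinAt b b' s t) :
    HasDerivWithinAt (fun r => a r ⬝ᵥ b r) (a' ⬝ᵥ b t + a t ⬝ᵥ b') s t := by
  have h := HasDerivWithinAt.fun_sum (u := Finset.univ) fun i _ =>
    (hasDerivWithinAt_pi.1 ha i).mul (hasDerivWithinAt_pi.1 hb i)
  rw [Finset.sum_add_distrib] at h
  exact h

theorem HasDerivWithinAt.mulVec {n : ℕ} {C : ℝ → Matrix (Fin n) (Fin n) ℝ}
    {C' : Matrix (Fin n) (Fin n) ℝ} {b : ℝ → Fin n → ℝ} {b' : Fin n → ℝ}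
    {s : Set ℝ} {t : ℝ} (hC : HasDerivWithinAt C C' s t) (hb : HasDerivWithinAt b b' s t) :
    HasDerivWithinAt (fun r => C r *ᵥ b r) (C' *ᵥ b t + C t *ᵥ b') s t :=
  hasDerivWithinAt_pi.2 fun i => (hasDerivWithinAt_pi.1 hC i).dotProduct hb

/-- The time derivative of the logarithm of a Gaussian density. -/
theorem hasDerivWithinAt_log_gaussianDensity {n : ℕ} {μ : ℝ → Fin n → ℝ}
    {C : ℝ → Matrix (Fin n) (Fin n) ℝ} {c : Fin n → ℝ} {C' : Matrix (Fin n) (Fin n) ℝ}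
    {s : Set ℝ} {t : ℝ} (ht : t ∈ s) (hpos : ∀ r ∈ s, (C r).PosDef)
    (hμ : HasDerivWithinAt μ c s t) (hC : HasDerivWithinAt C C' s t) (x : Fin n → ℝ) :
    HasDerivWithinAt (fun r => Real.log (gaussianDensity (μ r) (C r) x))
      (-(1 / 2) * ((C t)⁻¹ * C').trace + c ⬝ᵥ ((C t)⁻¹ *ᵥ (x - μ t))
        + 1 / 2 * ((x - μ t) ⬝ᵥ (((C t)⁻¹ * C' * (C t)⁻¹) *ᵥ (x - μ t)))) s t := by
  have hS := hpos t ht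
  have h1 := hC.matrix_det.log hS.det_pos.ne'
  have hy : HasDerivWithinAt (fun r => x - μ r) (-c) s t := hμ.const_sub x
  have h2 := hy.dotProduct ((hC.matrix_inv hS.isUnit).mulVec hy)
  have h3 := ((h1.const_add (n * Real.log (2 * Real.pi))).const_mul (-(1 / 2))).sub
    (h2.const_mul (1 / 2))
  refine (h3.congr (fun r hr => log_gaussianDensity (hpos r hr) _ _)
    (log_gaussianDensity hS _ _)).congr_deriv ?_
  have h4 : ((C t).adjugate * C').trace / (C t).det = ((C t)⁻¹ * C').trace := by
    rw [Matrix.inv_def, Ring.inverse_eq_inv', Matrix.smul_mul, Matrix.trace_smul, smul_eq_mul]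
    ring
  -- By symmetry the two terms linear in `c` coincide, which cancels the factor `1/2`.
  have h5 : (x - μ t) ⬝ᵥ ((C t)⁻¹ *ᵥ c) = c ⬝ᵥ ((C t)⁻¹ *ᵥ (x - μ t)) := by
    rw [hS.dotProduct_inv_mulVec, dotProduct_comm]
  rw [h4]
  simp only [Matrix.mulVec_neg, Matrix.neg_mulVec, dotProduct_add, dotProduct_neg, neg_dotProduct]
  rw [h5]
  ring

/-! ### Velocity field of the process and the Fokker–Planck equation -/

namespace LinearGaussianProcess

variable {n m : ℕ} (P : LinearGaussianProcess n m)

/-- The matrix `K = A + D Σ⁻¹` of the local mean velocity `J / p = μ' + K (x - μ)`. -/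
noncomputable def velocityMatrix (t : ℝ) : Matrix (Fin n) (Fin n) ℝ :=
  P.A + P.D t * (P.cov t)⁻¹

/-- The quotient of `∂J_i/∂x_i` by the density. -/
noncomputable def currentDivergence (t : ℝ) (i : Fin n) (x : Fin n → ℝ) : ℝ :=
  P.velocityMatrix t i i - (P.meanDot t i + P.velocityMatrix t i ⬝ᵥ (x - P.mean t)) *
    (Pi.single i 1 ⬝ᵥ ((P.cov t)⁻¹ *ᵥ (x - P.mean t)))

theorem meanDot_eq {t : ℝ} (ht : 0 ≤ t) : P.meanDot t = P.A *ᵥ P.mean t + P.B *ᵥ P.u t :=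
  (P.mean_ode t ht).derivWithin (uniqueDiffOn_Ici 0 t ht)

theorem covDot_eq {t : ℝ} (ht : 0 ≤ t) :
    P.covDot t = P.A * P.cov t + P.cov t * P.Aᵀ + (2 : ℝ) • P.D t := by
  ext i j
  exact (P.cov_ode t ht i j).derivWithin (uniqueDiffOn_Ici 0 t ht)

theorem hasDerivWithinAt_mean {t : ℝ} (ht : 0 ≤ t) :
    HasDerivWithinAt P.mean (P.meanDot t) (Ici 0) t := by
  rw [P.meanDot_eq ht]
  exact P.mean_ode t ht

theorem hasDerivWithinAt_cov {t : ℝ} (ht : 0 ≤ t) :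
    HasDerivWithinAt P.cov (P.covDot t) (Ici 0) t := by
  rw [P.covDot_eq ht]
  exact hasDerivWithinAt_matrix.2 (P.cov_ode t ht)

theorem D_transpose {t : ℝ} (ht : 0 ≤ t) : (P.D t)ᵀ = P.D t :=
  (P.D_isDiag t ht).isSymm

theorem velocityMatrix_mul_cov {t : ℝ} (ht : 0 ≤ t) :
    P.velocityMatrix t * P.cov t = P.A * P.cov t + P.D t := by
  rw [velocityMatrix, add_mul, Matrix.mul_assoc,
    Matrix.nonsing_inv_mul _ (P.cov_posDef t ht).isUnit_det, mul_one]

/-- Since `K Σ = A Σ + D`, the noise term `2 D` splits evenly between `K Σ` and its transpose: the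
covariance evolves as under a noiseless flow with matrix `K`. -/
theorem covDot_eq_velocityMatrix {t : ℝ} (ht : 0 ≤ t) :
    P.covDot t = P.velocityMatrix t * P.cov t + P.cov t * (P.velocityMatrix t)ᵀ := by
  have h : P.cov t * (P.velocityMatrix t)ᵀ = P.cov t * P.Aᵀ + P.D t := by
    have h1 := congrArg Matrix.transpose (P.velocityMatrix_mul_cov ht)
    rwa [Matrix.transpose_mul, (P.cov_posDef t ht).transpose_eq, Matrix.transpose_add,
      Matrix.transpose_mul, (P.cov_posDef t ht).transpose_eq, P.D_transpose ht] at h1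
  rw [P.covDot_eq ht, h, P.velocityMatrix_mul_cov ht, two_smul]
  abel

theorem covDot_transpose {t : ℝ} (ht : 0 ≤ t) : (P.covDot t)ᵀ = P.covDot t := by
  rw [P.covDot_eq_velocityMatrix ht, Matrix.transpose_add, Matrix.transpose_mul,
    Matrix.transpose_mul, Matrix.transpose_transpose, (P.cov_posDef t ht).transpose_eq, add_comm]

theorem D_mulVec_apply {t : ℝ} (ht : 0 ≤ t) (v : Fin n → ℝ) (i : Fin n) :
    ∑ j, P.D t i j * v j = P.D t i i * v i :=
  Finset.sum_eq_single i (fun j _ hj => by rw [P.D_isDiag t ht hj.symm, zero_mul]) (by simp)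

theorem velocityMatrix_apply {t : ℝ} (ht : 0 ≤ t) (i j : Fin n) :
    P.velocityMatrix t i j = P.A i j + P.D t i i * (P.cov t)⁻¹ i j := by
  rw [velocityMatrix, Matrix.add_apply, Matrix.mul_apply,
    P.D_mulVec_apply ht fun k => (P.cov t)⁻¹ k j]

theorem velocityMatrix_row {t : ℝ} (ht : 0 ≤ t) (i : Fin n) :
    P.velocityMatrix t i = P.A i + P.D t i i • (P.cov t)⁻¹ i :=
  funext fun j => P.velocityMatrix_apply ht i j

theorem pdf_pos {t : ℝ} (ht : 0 ≤ t) (x : Fin n → ℝ) : 0 < P.pdf t x :=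
  gaussianDensity_pos (P.cov_posDef t ht) _ _

theorem force_eq {t : ℝ} (ht : 0 ≤ t) (x : Fin n → ℝ) (i : Fin n) :
    P.force t x i = P.meanDot t i + P.A i ⬝ᵥ (x - P.mean t) := by
  rw [P.meanDot_eq ht, force, dotProduct_sub]
  simp only [Pi.add_apply, Matrix.mulVec]
  change P.A i ⬝ᵥ x + _ = P.A i ⬝ᵥ P.mean t + _ + (P.A i ⬝ᵥ x - P.A i ⬝ᵥ P.mean t)
  ring

/-- Because `∇p = -Σ⁻¹y p`, diffusion adds `D Σ⁻¹ y` to the force `μ' + A y`. -/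
theorem current_eq {t : ℝ} (ht : 0 ≤ t) (x : Fin n → ℝ) (i : Fin n) :
    P.current t x i =
      (P.meanDot t i + P.velocityMatrix t i ⬝ᵥ (x - P.mean t)) * P.pdf t x := by
  have h : ∀ j, lineDeriv ℝ (P.pdf t) x (Pi.single j 1) =
      -(((P.cov t)⁻¹ *ᵥ (x - P.mean t)) j) * P.pdf t x := fun j => by
    have := (hasLineDerivAt_gaussianDensity (P.cov_posDef t ht) (P.mean t) x
      (Pi.single j 1)).lineDeriv
    rwa [single_one_dotProduct] at this
  rw [current, P.D_mulVec_apply ht fun j => lineDeriv ℝ (P.pdf t) x (Pi.single j 1), h,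
    P.force_eq ht, P.velocityMatrix_row ht, add_dotProduct, smul_dotProduct, smul_eq_mul]
  change _ = (P.meanDot t i + (_ + P.D t i i * ((P.cov t)⁻¹ *ᵥ (x - P.mean t)) i)) * P.pdf t x
  ring

theorem hasLineDerivAt_current {t : ℝ} (ht : 0 ≤ t) (x : Fin n → ℝ) (i : Fin n) :
    HasLineDerivAt ℝ (fun y => P.current t y i) (P.currentDivergence t i x * P.pdf t x) x
      (Pi.single i 1) := by
  simp only [P.current_eq ht]
  have h := (hasLineDerivAt_const_add_dotProduct_sub (P.meanDot t i) (P.velocityMatrix t i)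
    (P.mean t) x (Pi.single i 1)).mul
    (hasLineDerivAt_gaussianDensity (P.cov_posDef t ht) (P.mean t) x (Pi.single i 1))
  convert! h using 1
  rw [currentDivergence, dotProduct_single_one, pdf]
  ring

theorem hasDerivWithinAt_log_pdf {t : ℝ} (ht : 0 ≤ t) (x : Fin n → ℝ) :
    HasDerivWithinAt (fun s => Real.log (P.pdf s x))
      (-(1 / 2) * ((P.cov t)⁻¹ * P.covDot t).trace
        + P.meanDot t ⬝ᵥ ((P.cov t)⁻¹ *ᵥ (x - P.mean t))
        + 1 / 2 * ((x - P.mean t) ⬝ᵥ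
          (((P.cov t)⁻¹ * P.covDot t * (P.cov t)⁻¹) *ᵥ (x - P.mean t)))) (Ici 0) t :=
  hasDerivWithinAt_log_gaussianDensity (mem_Ici.2 ht) (fun r hr => P.cov_posDef r hr)
    (P.hasDerivWithinAt_mean ht) (P.hasDerivWithinAt_cov ht) x

theorem logPdfDot_eq {t : ℝ} (ht : 0 ≤ t) (x : Fin n → ℝ) :
    P.logPdfDot t x = -(1 / 2) * ((P.cov t)⁻¹ * P.covDot t).trace
        + P.meanDot t ⬝ᵥ ((P.cov t)⁻¹ *ᵥ (x - P.mean t))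
        + 1 / 2 * ((x - P.mean t) ⬝ᵥ
          (((P.cov t)⁻¹ * P.covDot t * (P.cov t)⁻¹) *ᵥ (x - P.mean t))) :=
  (P.hasDerivWithinAt_log_pdf ht x).derivWithin (uniqueDiffOn_Ici 0 t ht)

theorem pdfDot_eq {t : ℝ} (ht : 0 ≤ t) (x : Fin n → ℝ) :
    P.pdfDot t x = P.pdf t x * P.logPdfDot t x := by
  have h := (P.hasDerivWithinAt_log_pdf ht x).exp
  rw [← P.logPdfDot_eq ht, Real.exp_log (P.pdf_pos ht x)] at h
  have h1 : HasDerivWithinAt (fun s => P.pdf s x) (P.pdf t x * P.logPdfDot t x) (Ici 0) t :=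
    h.congr (fun s hs => (Real.exp_log (P.pdf_pos hs x)).symm)
      (Real.exp_log (P.pdf_pos ht x)).symm
  exact h1.derivWithin (uniqueDiffOn_Ici 0 t ht)

/-- The Fokker–Planck equation, divided by the density. -/
theorem logPdfDot_eq_neg_sum {t : ℝ} (ht : 0 ≤ t) (x : Fin n → ℝ) :
    P.logPdfDot t x = -∑ i, P.currentDivergence t i x := by
  have hS := P.cov_posDef t ht
  rw [P.logPdfDot_eq ht, P.covDot_eq_velocityMatrix ht]
  simp only [currentDivergence, single_one_dotProduct, Finset.sum_sub_distrib]
  set K := P.velocityMatrix t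
  set S := P.cov t
  set c := P.meanDot t
  set y := x - P.mean t
  have h1 : (S⁻¹ * (K * S + S * Kᵀ)).trace = 2 * ∑ i, K i i := by
    rw [mul_add, Matrix.trace_add, ← Matrix.mul_assoc S⁻¹ S, Matrix.nonsing_inv_mul _ hS.isUnit_det,
      one_mul, Matrix.trace_transpose, Matrix.trace_mul_comm, Matrix.mul_assoc,
      Matrix.mul_nonsing_inv _ hS.isUnit_det, mul_one, two_mul]
    rfl
  have h2 : S⁻¹ * (K * S + S * Kᵀ) * S⁻¹ = S⁻¹ * K + Kᵀ * S⁻¹ := by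
    rw [mul_add, add_mul, ← Matrix.mul_assoc S⁻¹ S, Matrix.nonsing_inv_mul _ hS.isUnit_det,
      one_mul, Matrix.mul_assoc, Matrix.mul_assoc, Matrix.mul_nonsing_inv _ hS.isUnit_det, mul_one]
  -- The two halves of the quadratic term are transposes of each other, so both equal `(K y) ·
  -- S⁻¹y`.
  have h3 : y ⬝ᵥ ((S⁻¹ * K) *ᵥ y) = (K *ᵥ y) ⬝ᵥ (S⁻¹ *ᵥ y) := by
    rw [← Matrix.mulVec_mulVec, hS.dotProduct_inv_mulVec, dotProduct_comm]
  have h4 : y ⬝ᵥ ((Kᵀ * S⁻¹) *ᵥ y) = (K *ᵥ y) ⬝ᵥ (S⁻¹ *ᵥ y) := by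
    rw [← Matrix.mulVec_mulVec, Matrix.dotProduct_mulVec, Matrix.vecMul_transpose]
  have h5 : ∑ i, (c i + K i ⬝ᵥ y) * (S⁻¹ *ᵥ y) i =
      c ⬝ᵥ (S⁻¹ *ᵥ y) + (K *ᵥ y) ⬝ᵥ (S⁻¹ *ᵥ y) := by
    rw [← add_dotProduct]
    rfl
  rw [h1, h2, Matrix.add_mulVec, dotProduct_add, h3, h4, h5]
  ring

theorem hasTemperateGrowth_velocity (t : ℝ) (i : Fin n) :
    (fun x => P.meanDot t i + P.velocityMatrix t i ⬝ᵥ (x - P.mean t)).HasTemperateGrowth :=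
  hasTemperateGrowth_const_add_dotProduct_sub _ _ _

theorem hasTemperateGrowth_currentDivergence (t : ℝ) (i : Fin n) :
    (P.currentDivergence t i).HasTemperateGrowth :=
  (Function.HasTemperateGrowth.const _).sub ((P.hasTemperateGrowth_velocity t i).mul
    ((Function.HasTemperateGrowth.const _).dotProduct
      ((hasTemperateGrowth_sub_const (P.mean t)).mulVec _)))

theorem hasTemperateGrowth_logPdfDot {t : ℝ} (ht : 0 ≤ t) :
    (P.logPdfDot t).HasTemperateGrowth := by
  have h : P.logPdfDot t = fun x => -∑ i, P.currentDivergence t i x :=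
    funext fun x => P.logPdfDot_eq_neg_sum ht x
  rw [h]
  exact (Function.HasTemperateGrowth.sum fun i _ => P.hasTemperateGrowth_currentDivergence t i).neg

theorem hasTemperateGrowth_log_pdf {t : ℝ} (ht : 0 ≤ t) :
    (fun x => Real.log (P.pdf t x)).HasTemperateGrowth :=
  hasTemperateGrowth_log_gaussianDensity (P.cov_posDef t ht) _

theorem integrable_mul_pdf {t : ℝ} (ht : 0 ≤ t) {F : (Fin n → ℝ) → ℝ}
    (hF : F.HasTemperateGrowth) : Integrable fun x => F x * P.pdf t x :=
  hF.integrable_mul_gaussianDensity (P.cov_posDef t ht) _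

theorem current_sq_div_eq {t : ℝ} (ht : 0 ≤ t) (i : Fin n) (x : Fin n → ℝ) :
    P.current t x i ^ 2 / (P.D t i i * P.pdf t x) =
      (P.D t i i)⁻¹ * ((P.meanDot t i + P.velocityMatrix t i ⬝ᵥ (x - P.mean t)) *
        (P.meanDot t i + P.velocityMatrix t i ⬝ᵥ (x - P.mean t)) * P.pdf t x) := by
  have h1 := P.D_pos t ht i
  have h2 := P.pdf_pos ht x
  rw [P.current_eq ht]
  field_simp

theorem current_mul_force_div_eq {t : ℝ} (ht : 0 ≤ t) (i : Fin n) (x : Fin n → ℝ) :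
    P.current t x i * P.force t x i / P.D t i i =
      (P.D t i i)⁻¹ * ((P.meanDot t i + P.velocityMatrix t i ⬝ᵥ (x - P.mean t)) *
        (P.meanDot t i + P.A i ⬝ᵥ (x - P.mean t)) * P.pdf t x) := by
  rw [P.current_eq ht, P.force_eq ht]
  ring

theorem currentRateIntegrand_eq {t : ℝ} (ht : 0 ≤ t) (i : Fin n) (x : Fin n → ℝ) :
    P.currentRateIntegrand t i x =
      P.currentDivergence t i x * P.pdf t x * Real.log (P.pdf t x) := by
  rw [currentRateIntegrand, (P.hasLineDerivAt_current ht x i).lineDeriv]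

/-! ### Convergence of the integrals -/

theorem integrable_current_sq_div {t : ℝ} (ht : 0 ≤ t) (i : Fin n) :
    Integrable fun x => P.current t x i ^ 2 / (P.D t i i * P.pdf t x) := by
  simp only [P.current_sq_div_eq ht]
  exact (P.integrable_mul_pdf ht ((P.hasTemperateGrowth_velocity t i).mul
    (P.hasTemperateGrowth_velocity t i))).const_mul _

theorem integrable_current_mul_force_div {t : ℝ} (ht : 0 ≤ t) (i : Fin n) :
    Integrable fun x => P.current t x i * P.force t x i / P.D t i i := by
  simp only [P.current_mul_force_div_eq ht]
  exact (P.integrable_mul_pdf ht ((P.hasTemperateGrowth_velocity t i).mul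
    (hasTemperateGrowth_const_add_dotProduct_sub _ _ _))).const_mul _

theorem integrable_currentRateIntegrand {t : ℝ} (ht : 0 ≤ t) (i : Fin n) :
    Integrable (P.currentRateIntegrand t i) := by
  refine (P.integrable_mul_pdf ht ((P.hasTemperateGrowth_currentDivergence t i).mul
    (P.hasTemperateGrowth_log_pdf ht))).congr (Filter.Eventually.of_forall fun x => ?_)
  simp only [P.currentRateIntegrand_eq ht, Pi.mul_apply]
  ring

theorem integrable_pdf_mul_logPdfDot_sq {t : ℝ} (ht : 0 ≤ t) :
    Integrable fun x => P.pdf t x * P.logPdfDot t x ^ 2 := by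
  refine (P.integrable_mul_pdf ht ((P.hasTemperateGrowth_logPdfDot ht).pow 2)).congr
    (Filter.Eventually.of_forall fun x => ?_)
  exact mul_comm _ _

theorem integrable_pdfDot_mul_log_pdf {t : ℝ} (ht : 0 ≤ t) :
    Integrable fun x => P.pdfDot t x * Real.log (P.pdf t x) := by
  refine (P.integrable_mul_pdf ht ((P.hasTemperateGrowth_logPdfDot ht).mul
    (P.hasTemperateGrowth_log_pdf ht))).congr (Filter.Eventually.of_forall fun x => ?_)
  simp only [P.pdfDot_eq ht, Pi.mul_apply]
  ring

/-! ### Closed forms of the entropic quantities -/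

theorem dotProduct_cov_mulVec_inv_row {t : ℝ} (ht : 0 ≤ t) (a : Fin n → ℝ) (i : Fin n) :
    a ⬝ᵥ (P.cov t *ᵥ (P.cov t)⁻¹ i) = a i := by
  have hS := P.cov_posDef t ht
  have h : (P.cov t)⁻¹ i = (P.cov t)⁻¹ *ᵥ Pi.single i 1 := by
    rw [Matrix.mulVec_single_one, ← Matrix.row_transpose, hS.inv.transpose_eq]
    rfl
  rw [h, Matrix.mulVec_mulVec, Matrix.mul_nonsing_inv _ hS.isUnit_det, Matrix.one_mulVec,
    dotProduct_single_one]

theorem currentProduction_eq {t : ℝ} (ht : 0 ≤ t) (i : Fin n) :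
    P.currentProduction t i = (P.meanDot t i ^ 2 +
      (P.velocityMatrix t * P.cov t * (P.velocityMatrix t)ᵀ) i i) / P.D t i i := by
  simp only [currentProduction, P.current_sq_div_eq ht]
  rw [integral_const_mul, Matrix.mul_mul_transpose_apply_self]
  unfold pdf
  rw [integral_affine_mul_affine_mul_gaussianDensity (P.cov_posDef t ht)]
  ring

theorem currentFlow_eq {t : ℝ} (ht : 0 ≤ t) (i : Fin n) :
    P.currentFlow t i = (P.meanDot t i ^ 2 +
      P.velocityMatrix t i ⬝ᵥ (P.cov t *ᵥ P.A i)) / P.D t i i := by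
  simp only [currentFlow, P.current_mul_force_div_eq ht]
  rw [integral_const_mul]
  unfold pdf
  rw [integral_affine_mul_affine_mul_gaussianDensity (P.cov_posDef t ht)]
  ring

/-- Integration by parts moves `∂_i` onto `ln p`, whose derivative is `-(Σ⁻¹y)_i`; what remains is
the second moment of `K_i · y` and `(Σ⁻¹y)_i`, namely `(K Σ Σ⁻¹)_ii`. -/
theorem currentRate_eq {t : ℝ} (ht : 0 ≤ t) (i : Fin n) :
    P.currentRate t i = P.velocityMatrix t i i := by
  have hS := P.cov_posDef t ht
  have hlin : (fun x => -(Pi.single i 1 ⬝ᵥ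
      ((P.cov t)⁻¹ *ᵥ (x - P.mean t)))).HasTemperateGrowth :=
    ((Function.HasTemperateGrowth.const _).dotProduct
      ((hasTemperateGrowth_sub_const (P.mean t)).mulVec _)).neg
  have h := integral_lineDeriv_mul_gaussianDensity_mul hS (P.mean t) (Pi.single i 1)
    (P.hasTemperateGrowth_velocity t i) (.const (P.velocityMatrix t i i))
    (fun x => by
      simpa only [dotProduct_single_one] using
        hasLineDerivAt_const_add_dotProduct_sub (P.meanDot t i) (P.velocityMatrix t i)
          (P.mean t) x (Pi.single i 1))
    (P.hasTemperateGrowth_log_pdf ht) hlin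
    (fun x => hasLineDerivAt_log_gaussianDensity hS (P.mean t) x (Pi.single i 1))
  have h1 : ∀ y, Pi.single i 1 ⬝ᵥ ((P.cov t)⁻¹ *ᵥ y) = 0 + (P.cov t)⁻¹ i ⬝ᵥ y := fun y => by
    rw [single_one_dotProduct, zero_add]
    rfl
  simp only [currentRate, P.currentRateIntegrand_eq ht]
  refine h.trans ?_
  rw [← integral_neg]
  simp only [mul_neg, neg_mul, neg_neg, h1]
  rw [integral_affine_mul_affine_mul_gaussianDensity hS, P.dotProduct_cov_mulVec_inv_row ht]
  ring

/-- Expanding the second factor of `K_i · Σ K_i` by `K_i = A_i + D_ii (Σ⁻¹)_i` separates the flow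
from `D_ii K_ii`. -/
theorem currentRate_eq_sub {t : ℝ} (ht : 0 ≤ t) (i : Fin n) :
    P.currentRate t i = P.currentProduction t i - P.currentFlow t i := by
  have hD := P.D_pos t ht i
  have h1 : P.velocityMatrix t i ⬝ᵥ (P.cov t *ᵥ P.velocityMatrix t i) =
      P.velocityMatrix t i ⬝ᵥ (P.cov t *ᵥ P.A i) + P.D t i i * P.velocityMatrix t i i := by
    conv_lhs => rw [P.velocityMatrix_row ht i, Matrix.mulVec_add, dotProduct_add,
      Matrix.mulVec_smul, dotProduct_smul, P.dotProduct_cov_mulVec_inv_row ht, smul_eq_mul,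
      ← P.velocityMatrix_row ht i]
  rw [P.currentRate_eq ht, P.currentProduction_eq ht, Matrix.mul_mul_transpose_apply_self,
    P.currentFlow_eq ht, h1]
  field_simp
  ring

theorem entropyRate_eq_sum {t : ℝ} (ht : 0 ≤ t) :
    P.entropyRate t = ∑ i, P.currentRate t i := by
  simp only [currentRate]
  rw [entropyRate, ← integral_neg,
    ← integral_finsetSum _ fun i _ => P.integrable_currentRateIntegrand ht i]
  refine integral_congr_ae (Filter.Eventually.of_forall fun x => ?_)
  simp only [P.pdfDot_eq ht, P.logPdfDot_eq_neg_sum ht, P.currentRateIntegrand_eq ht,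
    ← Finset.sum_mul]
  ring

theorem entropyProduction_eq_sum {t : ℝ} (ht : 0 ≤ t) :
    P.entropyProduction t = ∑ i, P.currentProduction t i :=
  integral_finsetSum _ fun i _ => P.integrable_current_sq_div ht i

/-- Here `Σ⁻¹Σ' = Σ⁻¹KΣ + Kᵀ`: both squares have trace `Tr K²`, and the two cross terms have equal
traces. -/
theorem trace_sq_eq {t : ℝ} (ht : 0 ≤ t) :
    1 / 2 * (((P.cov t)⁻¹ * P.covDot t) ^ 2).trace =
      (P.velocityMatrix t * P.velocityMatrix t).trace +
        ((P.cov t)⁻¹ * (P.velocityMatrix t * P.cov t * (P.velocityMatrix t)ᵀ)).trace := by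
  have hS := P.cov_posDef t ht
  rw [P.covDot_eq_velocityMatrix ht]
  set K := P.velocityMatrix t
  set S := P.cov t
  have h : S⁻¹ * (K * S + S * Kᵀ) = S⁻¹ * (K * S) + Kᵀ := by
    rw [mul_add, ← Matrix.mul_assoc S⁻¹ S, Matrix.nonsing_inv_mul _ hS.isUnit_det, one_mul]
  have h1 : (S⁻¹ * (K * S) * (S⁻¹ * (K * S))).trace = (K * K).trace := by
    have : S⁻¹ * (K * S) * (S⁻¹ * (K * S)) = S⁻¹ * (K * K * S) := by
      simp only [Matrix.mul_assoc]
      rw [← Matrix.mul_assoc S S⁻¹, Matrix.mul_nonsing_inv _ hS.isUnit_det, one_mul]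
    rw [this, Matrix.trace_mul_comm, Matrix.mul_assoc, Matrix.mul_nonsing_inv _ hS.isUnit_det,
      mul_one]
  have h2 : (Kᵀ * Kᵀ).trace = (K * K).trace := by
    rw [← Matrix.transpose_mul, Matrix.trace_transpose]
  have h3 : S⁻¹ * (K * S) * Kᵀ = S⁻¹ * (K * S * Kᵀ) := Matrix.mul_assoc _ _ _
  rw [h, sq, add_mul, mul_add, mul_add, Matrix.trace_add, Matrix.trace_add, Matrix.trace_add, h1,
    h2, Matrix.trace_mul_comm Kᵀ, h3]
  ring

/-! ### The information rate and its bound -/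

theorem hasLineDerivAt_logPdfDot {t : ℝ} (ht : 0 ≤ t) (x v : Fin n → ℝ) :
    HasLineDerivAt ℝ (P.logPdfDot t)
      (((P.cov t)⁻¹ *ᵥ P.meanDot t) ⬝ᵥ v +
        v ⬝ᵥ (((P.cov t)⁻¹ * P.covDot t * (P.cov t)⁻¹) *ᵥ (x - P.mean t))) x v := by
  have hS := P.cov_posDef t ht
  have hG : ((P.cov t)⁻¹ * P.covDot t * (P.cov t)⁻¹)ᵀ =
      (P.cov t)⁻¹ * P.covDot t * (P.cov t)⁻¹ := by
    rw [Matrix.transpose_mul, Matrix.transpose_mul, P.covDot_transpose ht, hS.inv.transpose_eq,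
      Matrix.mul_assoc]
  have h : P.logPdfDot t = fun x => (-(1 / 2) * ((P.cov t)⁻¹ * P.covDot t).trace
        + ((P.cov t)⁻¹ *ᵥ P.meanDot t) ⬝ᵥ (x - P.mean t))
        + 1 / 2 * ((x - P.mean t) ⬝ᵥ
          (((P.cov t)⁻¹ * P.covDot t * (P.cov t)⁻¹) *ᵥ (x - P.mean t))) :=
    funext fun x => by rw [P.logPdfDot_eq ht, hS.dotProduct_inv_mulVec (P.meanDot t)]
  have h1 := HasDerivAt.add (hasLineDerivAt_const_add_dotProduct_sub
      (-(1 / 2) * ((P.cov t)⁻¹ * P.covDot t).trace)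
      ((P.cov t)⁻¹ *ᵥ P.meanDot t) (P.mean t) x v)
    (HasDerivAt.const_mul (1 / 2) (hasLineDerivAt_quadratic
      ((P.cov t)⁻¹ * P.covDot t * (P.cov t)⁻¹) (P.mean t) x v))
  rw [hG, ← two_smul ℝ, Matrix.smul_mulVec, dotProduct_smul, smul_eq_mul] at h1
  rw [h]
  unfold HasLineDerivAt
  convert! h1 using 1
  ring

/-- One factor `∂ₜ ln p` is replaced by minus the divergence of the current over `p`, then
integrated by parts. The gradient of the other factor is affine, so second moments suffice although
the integrand is quartic times `p`. -/
theorem integral_pdf_mul_logPdfDot_sq {t : ℝ} (ht : 0 ≤ t) :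
    ∫ x, P.pdf t x * P.logPdfDot t x ^ 2 =
      P.meanDot t ⬝ᵥ ((P.cov t)⁻¹ *ᵥ P.meanDot t) +
        ((P.velocityMatrix t * P.velocityMatrix t).trace +
          ((P.cov t)⁻¹ * (P.velocityMatrix t * P.cov t * (P.velocityMatrix t)ᵀ)).trace) := by
  have hS := P.cov_posDef t ht
  set K := P.velocityMatrix t with hK
  set S := P.cov t with hSdef
  set c := P.meanDot t
  set G : Matrix (Fin n) (Fin n) ℝ := S⁻¹ * P.covDot t * S⁻¹ with hGdef
  have hi : ∀ i, Integrable fun x => P.currentDivergence t i x * P.pdf t x * P.logPdfDot t x := by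
    intro i
    refine (P.integrable_mul_pdf ht ((P.hasTemperateGrowth_currentDivergence t i).mul
      (P.hasTemperateGrowth_logPdfDot ht))).congr (Filter.Eventually.of_forall fun x => ?_)
    simp only [Pi.mul_apply]
    ring
  have h1 : ∀ i, ∫ x, P.currentDivergence t i x * P.pdf t x * P.logPdfDot t x =
      -(c i * (S⁻¹ *ᵥ c) i + K i ⬝ᵥ (S *ᵥ G i)) := by
    intro i
    have hl : (fun x => (S⁻¹ *ᵥ c) i + G i ⬝ᵥ (x - P.mean t)).HasTemperateGrowth :=
      hasTemperateGrowth_const_add_dotProduct_sub _ _ _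
    have h := integral_lineDeriv_mul_gaussianDensity_mul hS (P.mean t) (Pi.single i 1)
      (P.hasTemperateGrowth_velocity t i) (.const (P.velocityMatrix t i i))
      (fun x => by
        simpa only [dotProduct_single_one] using
          hasLineDerivAt_const_add_dotProduct_sub (P.meanDot t i) (P.velocityMatrix t i)
            (P.mean t) x (Pi.single i 1))
      (P.hasTemperateGrowth_logPdfDot ht) hl
      (fun x => by
        have := P.hasLineDerivAt_logPdfDot ht x (Pi.single i 1)
        rw [dotProduct_single_one, single_one_dotProduct] at this
        exact this)
    refine h.trans ?_
    rw [integral_affine_mul_affine_mul_gaussianDensity hS]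
  have h2 : ∀ x, P.pdf t x * P.logPdfDot t x ^ 2 =
      -∑ i, P.currentDivergence t i x * P.pdf t x * P.logPdfDot t x := by
    intro x
    rw [← Finset.sum_mul, ← Finset.sum_mul]
    have := P.logPdfDot_eq_neg_sum ht x
    rw [show ∑ i, P.currentDivergence t i x = -P.logPdfDot t x by rw [this, neg_neg]]
    ring
  have h3 : ∑ i, K i ⬝ᵥ (S *ᵥ G i) = (K * S * Gᵀ).trace := by
    rw [Matrix.trace]
    refine Finset.sum_congr rfl fun i _ => ?_
    exact (K.mul_mul_transpose_apply_self S G i).symm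
  have hG : Gᵀ = S⁻¹ * (P.covDot t * S⁻¹) := by
    rw [hGdef, Matrix.transpose_mul, Matrix.transpose_mul, P.covDot_transpose ht,
      hS.inv.transpose_eq]
  have h4 : (K * S * Gᵀ).trace = (K * K).trace + (S⁻¹ * (K * S * Kᵀ)).trace := by
    rw [hG, Matrix.mul_assoc, ← Matrix.mul_assoc S S⁻¹, Matrix.mul_nonsing_inv _ hS.isUnit_det,
      one_mul, P.covDot_eq_velocityMatrix ht, ← hK, ← hSdef, add_mul, Matrix.mul_assoc K S,
      Matrix.mul_nonsing_inv _ hS.isUnit_det, mul_one, mul_add, Matrix.trace_add,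
      Matrix.trace_mul_comm S⁻¹]
    simp only [Matrix.mul_assoc]
  simp only [h2]
  rw [integral_neg, integral_finsetSum _ fun i _ => hi i]
  simp only [h1]
  rw [Finset.sum_neg_distrib, neg_neg, Finset.sum_add_distrib, h3, h4]
  rfl

theorem informationRate_sq {t : ℝ} (ht : 0 ≤ t) :
    P.informationRate t ^ 2 = P.meanDot t ⬝ᵥ ((P.cov t)⁻¹ *ᵥ P.meanDot t) +
      1 / 2 * (((P.cov t)⁻¹ * P.covDot t) ^ 2).trace := by
  rw [informationRate, Real.sq_sqrt, P.integral_pdf_mul_logPdfDot_sq ht, P.trace_sq_eq ht]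
  exact integral_nonneg fun x => mul_nonneg (P.pdf_pos ht x).le (sq_nonneg _)

/-- Subtracting `2 g` removes the cross terms of `Ṡ² = (∑ K_ii)²`, leaving `∑ K_ii²`. -/
theorem rateBound_eq {t : ℝ} (ht : 0 ≤ t) :
    P.rateBound t = (P.cov t)⁻¹.trace * (∑ i, (P.meanDot t i ^ 2 +
      (P.velocityMatrix t * P.cov t * (P.velocityMatrix t)ᵀ) i i) / P.D t i i) *
        (∑ i, P.D t i i) + ∑ i, P.velocityMatrix t i i ^ 2 := by
  rw [rateBound, add_sub_assoc, P.entropyRate_eq_sum ht, sum_sq_eq_sq_sub_pairSum,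
    P.entropyProduction_eq_sum ht]
  simp only [P.currentRate_eq ht, P.currentProduction_eq ht]
  rfl

theorem informationRate_sq_le_rateBound {t : ℝ} (ht : 0 ≤ t) :
    P.informationRate t ^ 2 ≤ P.rateBound t := by
  rw [P.informationRate_sq ht, P.trace_sq_eq ht, P.rateBound_eq ht]
  exact (P.cov_posDef t ht).rate_inequality _ _ _ (P.D_pos t ht)

/-! ### Continuity in time and the information length -/

theorem continuousOn_mean : ContinuousOn P.mean (Ici 0) :=
  fun t ht => (P.mean_ode t ht).continuousWithinAt

theorem continuousOn_cov : ContinuousOn P.cov (Ici 0) :=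
  continuousOn_pi.2 fun i => continuousOn_pi.2 fun j t ht =>
    (P.cov_ode t ht i j).continuousWithinAt

theorem continuousOn_cov_inv : ContinuousOn (fun t => (P.cov t)⁻¹) (Ici 0) := fun t ht =>
  ContinuousAt.comp_continuousWithinAt (f := P.cov) (g := Inv.inv)
    (continuousAt_matrix_inv _ (by
      rw [Ring.inverse_eq_inv']
      exact continuousAt_inv₀ (P.cov_posDef t ht).det_pos.ne'))
    (P.continuousOn_cov t ht)

theorem continuousOn_meanDot : ContinuousOn P.meanDot (Ici 0) := by
  have h : ContinuousOn (fun t => P.A *ᵥ P.mean t + P.B *ᵥ P.u t) (Ici 0) :=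
    ((continuous_const.matrix_mulVec continuous_id).comp_continuousOn P.continuousOn_mean).add
      ((continuous_const.matrix_mulVec continuous_id).comp_continuousOn P.u_continuousOn)
  exact h.congr fun t ht => P.meanDot_eq ht

/-- The closed forms are continuous expressions in `μ'`, `Σ`, `Σ⁻¹` and `D`, with denominators `D_ii
> 0`; no limit under the space integrals is needed. -/
theorem continuousOn_informationRate_and_rateBound {T : ℝ} (hD : ContinuousOn P.D (Icc 0 T)) :
    ContinuousOn P.informationRate (Icc 0 T) ∧ ContinuousOn P.rateBound (Icc 0 T) := by
  have hsub : Icc 0 T ⊆ Ici (0 : ℝ) := Icc_subset_Ici_self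
  have hS : Continuous fun t : Icc 0 T => P.cov t := (P.continuousOn_cov.mono hsub).domRestrict
  have hQ : Continuous fun t : Icc 0 T => (P.cov t)⁻¹ :=
    (P.continuousOn_cov_inv.mono hsub).domRestrict
  have hc : Continuous fun t : Icc 0 T => P.meanDot t :=
    (P.continuousOn_meanDot.mono hsub).domRestrict
  have hDc : Continuous fun t : Icc 0 T => P.D t := hD.domRestrict
  have hK : Continuous fun t : Icc 0 T => P.velocityMatrix t := by
    unfold velocityMatrix
    exact continuous_const.add (hDc.matrix_mul hQ)
  have hM : Continuous fun t : Icc 0 T =>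
      P.velocityMatrix t * P.cov t * (P.velocityMatrix t)ᵀ :=
    (hK.matrix_mul hS).matrix_mul hK.matrix_transpose
  have hK2 : Continuous fun t : Icc 0 T => (P.velocityMatrix t * P.velocityMatrix t).trace :=
    (hK.matrix_mul hK).matrix_trace
  constructor
  · rw [continuousOn_iff_continuous_domRestrict]
    have h : (Icc 0 T).domRestrict P.informationRate = fun t : Icc 0 T =>
        √(P.meanDot t ⬝ᵥ ((P.cov t)⁻¹ *ᵥ P.meanDot t) +
          ((P.velocityMatrix t * P.velocityMatrix t).trace +
            ((P.cov t)⁻¹ * (P.velocityMatrix t * P.cov t * (P.velocityMatrix t)ᵀ)).trace)) := by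
      funext t
      rw [domRestrict_apply, informationRate, P.integral_pdf_mul_logPdfDot_sq t.2.1]
    rw [h]
    exact ((hc.dotProduct (hQ.matrix_mulVec hc)).add
      (hK2.add (hQ.matrix_mul hM).matrix_trace)).sqrt
  · rw [continuousOn_iff_continuous_domRestrict]
    have h : (Icc 0 T).domRestrict P.rateBound = fun t : Icc 0 T =>
        (P.cov t)⁻¹.trace * (∑ i, (P.meanDot t i ^ 2 +
          (P.velocityMatrix t * P.cov t * (P.velocityMatrix t)ᵀ) i i) / P.D t i i) *
            (∑ i, P.D t i i) + ∑ i, P.velocityMatrix t i i ^ 2 :=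
      funext fun t => P.rateBound_eq t.2.1
    rw [h]
    refine ((hQ.matrix_trace.mul (continuous_finsetSum _ fun i _ => ?_)).mul
      (continuous_finsetSum _ fun i _ => hDc.matrix_elem i i)).add
      (continuous_finsetSum _ fun i _ => (hK.matrix_elem i i).pow 2)
    exact ((((continuous_apply i).comp hc).pow 2).add (hM.matrix_elem i i)).div
      (hDc.matrix_elem i i) fun t => (P.D_pos t t.2.1 i).ne'

end LinearGaussianProcess

theorem mainTheorem2 {n m : ℕ} (P : LinearGaussianProcess n m) :
    (∀ t : ℝ, 0 ≤ t →
      (Integrable (fun x => P.pdf t x * P.logPdfDot t x ^ 2) ∧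
        Integrable (fun x => P.pdfDot t x * Real.log (P.pdf t x)) ∧
        ∀ i : Fin n,
          Integrable (fun x => P.current t x i ^ 2 / (P.D t i i * P.pdf t x)) ∧
          Integrable (fun x => P.current t x i * P.force t x i / P.D t i i) ∧
          Integrable (P.currentRateIntegrand t i)) ∧
      (∀ i : Fin n, P.currentRate t i = P.currentProduction t i - P.currentFlow t i) ∧
      P.informationRate t ^ 2 =
        P.meanDot t ⬝ᵥ ((P.cov t)⁻¹ *ᵥ P.meanDot t)
          + 1 / 2 * (((P.cov t)⁻¹ * P.covDot t) ^ 2).trace ∧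
      0 ≤ P.informationRate t ^ 2 ∧
      P.informationRate t ^ 2 ≤ P.rateBound t) ∧
    (∀ T : ℝ, 0 ≤ T → ContinuousOn P.D (Icc 0 T) →
      IntervalIntegrable P.informationRate volume 0 T ∧
      IntervalIntegrable (fun t => √(P.rateBound t)) volume 0 T ∧
      P.informationLength T ≤ ∫ t in (0 : ℝ)..T, √(P.rateBound t)) := by
  refine ⟨fun t ht => ⟨⟨P.integrable_pdf_mul_logPdfDot_sq ht, P.integrable_pdfDot_mul_log_pdf ht,
    fun i => ⟨P.integrable_current_sq_div ht i, P.integrable_current_mul_force_div ht i,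
      P.integrable_currentRateIntegrand ht i⟩⟩, P.currentRate_eq_sub ht, P.informationRate_sq ht,
    sq_nonneg _, P.informationRate_sq_le_rateBound ht⟩, fun T hT hD => ?_⟩
  obtain ⟨h1, h2⟩ := P.continuousOn_informationRate_and_rateBound hD
  have i1 : IntervalIntegrable P.informationRate volume 0 T :=
    h1.intervalIntegrable_of_Icc hT
  have i2 : IntervalIntegrable (fun t => √(P.rateBound t)) volume 0 T :=
    h2.sqrt.intervalIntegrable_of_Icc hT
  exact ⟨i1, i2, intervalIntegral.integral_mono_on hT i1 i2 fun t ht =>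
    Real.le_sqrt_of_sq_le (P.informationRate_sq_le_rateBound ht.1)⟩
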